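/- Let $K\ge 1$, $L\ge 0$, $\nu\in\mathbb R^L$, $\Sigma\in\mathbb R^{L\times L}$ symmetric positive definite, $b_1,\dots,b_K\in\mathbb R^L$, $\sigma>0$ and $\sigma_{0,1},\dots,\sigma_{0,K}>0$. In the hierarchical Gaussian bandit, $\mu\sim\mathcal N(\nu,\Sigma)$; given $\mu$, the mean rewards $\theta_i\sim\mathcal N(b_i^\top\mu,\sigma_{0,i}^2)$, $i\in[K]$, are independent; given $\mu$ and $\theta$, the rewards $Y_t\sim\mathcal N(\theta_{A_t},\sigma^2)$ are independent, where $A_t$ is the arm pulled in round $t$. Fix weights $\omega_i>0$ with $\sum_i\omega_i=1$. With budget $n$, the algorithm pulls each arm $i$ exactly $n_i=\lfloor\omega_i n\rfloor$ times, in a deterministic order, and returns $J_n\in\arg\max_{i}\mathbb E[\theta_i\mid H_n]$, where $H_n$ is the history of arms and rewards and $J_n$ is a measurable function of $H_n$ (ties are broken arbitrarily). Let $i_*(\theta)$ be the (almost surely unique) maximizer of $i\mapsto\theta_i$, and let $\mathcal P_n=\mathbb E[\mathbb P(J_n\ne i_*(\theta)\mid\theta)]$ be the expected probability of error. Put $d_k=n_k\sigma_{0,k}^2+\sigma^2$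 and $$\breve\Sigma_n=\Big(\Sigma^{-1}+\sum_{k}\tfrac{n_k}{d_k}b_kb_k^\top\Big)^{-1},\quad \tilde\sigma_{n,i}^2=\Big(\tfrac1{\sigma_{0,i}^2}+\tfrac{n_i}{\sigma^2}\Big)^{-1},\quad \hat\sigma_{n,i}^2=\tilde\sigma_{n,i}^2+\tfrac{\tilde\sigma_{n,i}^4}{\sigma_{0,i}^4}\,b_i^\top\breve\Sigma_nb_i .$$ Let $V_{kk}=n_k\sigma^2+n_k^2(\sigma_{0,k}^2+b_k^\top\Sigma b_k)$, $V_{kk'}=n_kn_{k'}b_k^\top\Sigma b_{k'}$ for $k\ne k'$, $g_{ki}=b_k^\top\breve\Sigma_nb_i$, and define $$\begin{aligned}c_{i,j}={}&\tfrac{\sigma_{0,i}^4}{d_i^2}V_{ii}+\tfrac{\sigma_{0,j}^4}{d_j^2}V_{jj}+\tfrac{\sigma^4}{d_i^2}\sum_{k,k'}\tfrac{g_{ki}g_{k'i}}{d_kd_{k'}}V_{kk'}+\tfrac{\sigma^4}{d_j^2}\sum_{k,k'}\tfrac{g_{kj}g_{k'j}}{d_kd_{k'}}V_{kk'}-\t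frac{2\sigma^4}{d_id_j}\sum_{k,k'}\tfrac{g_{ki}g_{k'j}}{d_kd_{k'}}V_{kk'}-\tfrac{2\sigma_{0,i}^2\sigma_{0,j}^2}{d_id_j}V_{ij}\\&+\tfrac{2\sigma^2\sigma_{0,i}^2}{d_i^2}\sum_k\tfrac{g_{ki}}{d_k}V_{ki}+\tfrac{2\sigma^2\sigma_{0,j}^2}{d_j^2}\sum_k\tfrac{g_{kj}}{d_k}V_{kj}-\tfrac{2\sigma^2\sigma_{0,j}^2}{d_id_j}\sum_k\tfrac{g_{ki}}{d_k}V_{kj}-\tfrac{2\sigma^2\sigma_{0,i}^2}{d_id_j}\sum_k\tfrac{g_{kj}}{d_k}V_{ki}.\end{aligned}$$ Then, for every $n\ge 0$, $c_{i,j}=\mathbb V\big(\mathbb E[\theta_i\mid H_n]-\mathbb E[\theta_j\mid H_n]\big)$ for all $i,j$, and $$\mathcal P_n\le\sum_{i\ne j}\frac{1}{\sqrt{1+\frac{c_{i,j}}{\hat\sigma_{n,i}^2+\hat\sigma_{n,j}^2}}}\exp\left(-\frac{(\nu^\top b_i-\nu^\top b_j)^2}{2\big((b_i-b_j)^\top\Sigma(b_i-b_j)+\sigma_{0,i}^2+\sigma_{0,j}^2\big)}\right),$$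 where the sum is over ordered pairs. Moreover, as $n\to\infty$ with all other parameters fixed, $c_{i,j}=\Omega(1)$ for $i\ne j$ and $\hat\sigma_{n,i}^2=\Omega(1/n)$. In particular $\mathcal P_n=\mathcal O(1/\sqrt n)$: there is a constant $C$, depending only on the model parameters and $\omega$, with $\mathcal P_n\le C/\sqrt n$ for all $n\ge1$. -/

import Mathlib

open MeasureTheory ProbabilityTheory Filter Matrix

universe u

noncomputable section

/-! ### The hierarchical Gaussian bandit model -/

/-- The known parameters of a hierarchical Gaussian bandit with `K` arms and `L` effects:
the hyper-prior `N(ν, S)` of the effects, the mixing weights `b i`, the conditional standard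
deviations `σ₀ i` of the arms given the effects, and the standard deviation `σ` of the rewards. -/
structure HierParams (K L : ℕ) where
  ν : Fin L → ℝ
  S : Matrix (Fin L) (Fin L) ℝ
  b : Fin K → Fin L → ℝ
  σ₀ : Fin K → ℝ
  σ : ℝ

/-- A product of Gaussian laws depends measurably on the means. -/
theorem measurable_pi_gaussianReal {X ι : Type*} [MeasurableSpace X] [Fintype ι]
    (f : X → ι → ℝ) (hf : Measurable f) (v : ι → NNReal) :
    Measurable fun x => Measure.pi fun i => gaussianReal (f x i) (v i) := by
  have h : ∀ x, (Measure.pi fun i => gaussianReal (f x i) (v i)) =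
      ((Measure.pi fun i => gaussianReal 0 (v i)).map (Prod.mk x)).map
        (fun q : X × (ι → ℝ) => fun i => f q.1 i + q.2 i) := by
    intro x
    have hm : Measurable (fun q : X × (ι → ℝ) => fun i => f q.1 i + q.2 i) := by fun_prop
    rw [Measure.map_map hm measurable_prodMk_left]
    have := Measure.pi_map_pi (μ := fun i => gaussianReal 0 (v i))
      (f := fun i (y : ℝ) => f x i + y) (fun i => by fun_prop)
    simp only [gaussianReal_map_const_add, zero_add] at this
    exact this.symm
  simp_rw [h]
  exact (Measure.measurable_map _ (by fun_prop)).comp Measurable.map_prodMk_left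

/-- Given the effects `m`, the mean rewards `θ i ∼ N(b iᵀ m, σ₀ i ^ 2)` are independent. -/
def armKernel {K L : ℕ} (p : HierParams K L) :
    Kernel (EuclideanSpace ℝ (Fin L)) (Fin K → ℝ) where
  toFun m := Measure.pi fun i => gaussianReal (p.b i ⬝ᵥ m.ofLp) (Real.toNNReal (p.σ₀ i ^ 2))
  measurable' := by
    refine measurable_pi_gaussianReal
      (fun (m : EuclideanSpace ℝ (Fin L)) i => p.b i ⬝ᵥ m.ofLp) ?_ _
    unfold dotProduct
    fun_prop

/-- Given the effects and the mean rewards `q = (m, θ)`, the rewards `Y t ∼ N(θ (A t), σ ^ 2)` of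
the rounds `t`, in which the arms `A t` are pulled, are independent. -/
def rewardKernel {K L T : ℕ} (p : HierParams K L) (A : Fin T → Fin K) :
    Kernel (EuclideanSpace ℝ (Fin L) × (Fin K → ℝ)) (Fin T → ℝ) where
  toFun q := Measure.pi fun t => gaussianReal (q.2 (A t)) (Real.toNNReal (p.σ ^ 2))
  measurable' := by
    refine measurable_pi_gaussianReal
      (fun (q : EuclideanSpace ℝ (Fin L) × (Fin K → ℝ)) t => q.2 (A t)) ?_ _
    fun_prop

/-- The random effects `μ`, mean rewards `θ` and observed rewards `Y` follow the hierarchical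
Gaussian model with parameters `p`, where arm `A t` is pulled in round `t`. -/
structure IsHierBandit {K L T : ℕ} (p : HierParams K L) (A : Fin T → Fin K)
    {Ω : Type u} [MeasurableSpace Ω] (P : Measure Ω) (μ : Ω → EuclideanSpace ℝ (Fin L))
    (θ : Ω → Fin K → ℝ) (Y : Ω → Fin T → ℝ) : Prop where
  measurable_effects : Measurable μ
  measurable_means : Measurable θ
  measurable_rewards : Measurable Y
  law_effects : HasLaw μ (multivariateGaussian (WithLp.toLp 2 p.ν) p.S) P
  law_means : HasCondDistrib θ μ (armKernel p) P
  law_rewards : HasCondDistrib Y (fun x => (μ x, θ x)) (rewardKernel p A) P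

/-! ### The algorithm and its expected probability of error -/

/-- The number `⌊ω i * n⌋` of pulls of each arm under the allocation `ω` with budget `n`. -/
def pulls {K : ℕ} (ω : Fin K → ℝ) (n : ℕ) (i : Fin K) : ℕ := ⌊ω i * n⌋₊

/-- `A` is a schedule of the arms in which arm `i` is pulled exactly `⌊ω i * n⌋` times. -/
def IsSchedule {K T : ℕ} (ω : Fin K → ℝ) (n : ℕ) (A : Fin T → Fin K) : Prop :=
  ∀ i, (Finset.univ.filter fun t => A t = i).card = pulls ω n i

/-- The mean posterior reward `E[θ i | H]`. The schedule of the arms is deterministic, so the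
history `H` generates the σ-algebra of the rewards `Y`. -/
def posteriorMean {K T : ℕ} {Ω : Type u} [MeasurableSpace Ω] (P : Measure Ω)
    (θ : Ω → Fin K → ℝ) (Y : Ω → Fin T → ℝ) (i : Fin K) : Ω → ℝ :=
  P[fun x => θ x i | MeasurableSpace.comap Y inferInstance]

/-- `J` depends on the history only and maximizes the mean posterior reward (ties are broken in
an arbitrary way). -/
structure IsDecision {K T : ℕ} {Ω : Type u} [MeasurableSpace Ω] (P : Measure Ω)
    (θ : Ω → Fin K → ℝ) (Y : Ω → Fin T → ℝ) (J : Ω → Fin K) : Prop where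
  measurable : Measurable[MeasurableSpace.comap Y inferInstance] J
  argmax : ∀ᵐ x ∂P, ∀ i, posteriorMean P θ Y i x ≤ posteriorMean P θ Y (J x) x

/-- Arm `j` is the (unique) optimal arm of the instance `θ`. -/
def IsOptimalArm {K : ℕ} (θ : Fin K → ℝ) (j : Fin K) : Prop := ∀ i, i ≠ j → θ i < θ j

/-- The expected probability of error `E[P(J ≠ i_*(θ) | θ)]`. -/
def expectedPoE {K : ℕ} {Ω : Type u} [MeasurableSpace Ω] (P : Measure Ω)
    (θ : Ω → Fin K → ℝ) (J : Ω → Fin K) : ℝ :=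
  ∫ x, (P⟦{y | ¬ IsOptimalArm (θ y) (J y)} | MeasurableSpace.comap θ inferInstance⟧) x ∂P

/-! ### The closed-form quantities of the bound; `m k` is the number of pulls of arm `k` -/

namespace HierParams

variable {K L : ℕ} (p : HierParams K L) (m : Fin K → ℕ)

/-- The posterior covariance of the effects,
`(S⁻¹ + ∑ k, m k / (m k * σ₀ k ^ 2 + σ ^ 2) * b k * b kᵀ)⁻¹`. -/
def effectCov : Matrix (Fin L) (Fin L) ℝ :=
  (p.S⁻¹ + ∑ k, ((m k : ℝ) / (m k * p.σ₀ k ^ 2 + p.σ ^ 2)) • vecMulVec (p.b k) (p.b k))⁻¹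

/-- The posterior variance of `θ i` conditionally on the effects. -/
def condVar (i : Fin K) : ℝ := (1 / p.σ₀ i ^ 2 + (m i : ℝ) / p.σ ^ 2)⁻¹

/-- The number `b kᵀ * effectCov * b i`. -/
def g (k i : Fin K) : ℝ := p.b k ⬝ᵥ (p.effectCov m *ᵥ p.b i)

/-- The variance of the marginal posterior of `θ i`. -/
def margVar (i : Fin K) : ℝ :=
  p.condVar m i + p.condVar m i ^ 2 / p.σ₀ i ^ 4 * p.g m i i

/-- The covariance of the sums `B k`, `B k'` of the rewards collected from arms `k`, `k'`
(the variance of `B k` if `k = k'`). -/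
def covB (k k' : Fin K) : ℝ :=
  if k = k' then (m k : ℝ) * p.σ ^ 2 + (m k : ℝ) ^ 2 * (p.σ₀ k ^ 2 + p.b k ⬝ᵥ (p.S *ᵥ p.b k))
  else (m k : ℝ) * (m k' : ℝ) * (p.b k ⬝ᵥ (p.S *ᵥ p.b k'))

/-- The number `m k * σ₀ k ^ 2 + σ ^ 2`. -/
def d (k : Fin K) : ℝ := (m k : ℝ) * p.σ₀ k ^ 2 + p.σ ^ 2

/-- The explicit variance `c i j` of the difference of the marginal posterior means. -/
def c (i j : Fin K) : ℝ :=
  p.σ₀ i ^ 4 / p.d m i ^ 2 * p.covB m i i + p.σ₀ j ^ 4 / p.d m j ^ 2 * p.covB m j j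
  + p.σ ^ 4 / p.d m i ^ 2 *
      ∑ k, ∑ k', p.g m k i * p.g m k' i / (p.d m k * p.d m k') * p.covB m k k'
  + p.σ ^ 4 / p.d m j ^ 2 *
      ∑ k, ∑ k', p.g m k j * p.g m k' j / (p.d m k * p.d m k') * p.covB m k k'
  - 2 * p.σ ^ 4 / (p.d m i * p.d m j) *
      ∑ k, ∑ k', p.g m k i * p.g m k' j / (p.d m k * p.d m k') * p.covB m k k'
  - 2 * p.σ₀ i ^ 2 * p.σ₀ j ^ 2 / (p.d m i * p.d m j) * p.covB m i j
  + 2 * p.σ ^ 2 * p.σ₀ i ^ 2 / p.d m i ^ 2 * ∑ k, p.g m k i / p.d m k * p.covB m k i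
  + 2 * p.σ ^ 2 * p.σ₀ j ^ 2 / p.d m j ^ 2 * ∑ k, p.g m k j / p.d m k * p.covB m k j
  - 2 * p.σ ^ 2 * p.σ₀ j ^ 2 / (p.d m i * p.d m j) * ∑ k, p.g m k i / p.d m k * p.covB m k j
  - 2 * p.σ ^ 2 * p.σ₀ i ^ 2 / (p.d m i * p.d m j) * ∑ k, p.g m k j / p.d m k * p.covB m k i

/-- The prior variance `‖b i - b j‖_S² + σ₀ i ^ 2 + σ₀ j ^ 2` of `θ i - θ j`. -/
def gapVar (i j : Fin K) : ℝ :=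
  (p.b i - p.b j) ⬝ᵥ (p.S *ᵥ (p.b i - p.b j)) + p.σ₀ i ^ 2 + p.σ₀ j ^ 2

/-- The upper bound on the expected probability of error. -/
def poeBound : ℝ :=
  ∑ i, ∑ j ∈ Finset.univ.filter (fun j => j ≠ i),
    1 / Real.sqrt (1 + p.c m i j / (p.margVar m i + p.margVar m j)) *
      Real.exp (-(p.ν ⬝ᵥ p.b i - p.ν ⬝ᵥ p.b j) ^ 2 / (2 * p.gapVar i j))

end HierParams

end

/-! Everything is jointly Gaussian, so the posterior mean of `θ i` is, up to a constant, the linear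
predictor whose coefficients `gain` solve the normal equations. `gain_normal_eq` checks these
equations from `effectCov_mul`, the defining identity of the posterior covariance of the effects
multiplied by `S`. The prediction error is then uncorrelated with the rewards, hence independent of
them (`indepFun_predErr`), which gives `posteriorMean_ae_eq`.

Fix `i ≠ j`. The gap `D` between the posterior means and the centered error `R` of the difference
are independent, with laws `N(δ, c)` and `N(0, v)`, where `δ` is the prior mean gap, `v` is
`postVar`, and `v + c` is the prior variance `gapVar`. Returning `i` while `θ i ≤ θ j` forces `0 ≤
D` and `R + D ≤ 0`. The tail bound `P(R ≤ -y) ≤ exp(-y²/(2v))/2`, averaged over `D`, gives `(1/2)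
√(v/(v+c)) exp(-δ²/(2(v+c)))`. The stated bound has the sum `M` of the marginal variances in place
of `v`; since `v ≤ 2M`, the factor `1/2` pays for the exchange (`half_sqrt_le_inv_sqrt`). A union
bound over pairs concludes.

For the rate, each marginal variance is `O(1/n)`, so `v → 0`, `c` stays above `gapVar / 2`
eventually, and each summand is at most a multiple of `√(M/c)`. -/

noncomputable section

/-! ### Matrix algebra: normal equations, the closed form of `c`, and variance bounds. -/

namespace HierParams

variable {K L : ℕ} (p : HierParams K L) (m : Fin K → ℕ)

/-- The prior covariance of the mean rewards. -/
def armCov : Matrix (Fin K) (Fin K) ℝ :=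
  Matrix.of fun i j => p.b i ⬝ᵥ (p.S *ᵥ p.b j) + if i = j then p.σ₀ i ^ 2 else 0

/-- The coefficient, in the posterior mean of `θ i`, of the sum of the rewards of arm `k`. -/
def gain (i k : Fin K) : ℝ :=
  (if i = k then p.σ₀ i ^ 2 / p.d m i else 0) + p.σ ^ 2 / p.d m i * (p.g m k i / p.d m k)

/-- The posterior variance of `θ i - θ j`. -/
def postVar (i j : Fin K) : ℝ :=
  p.σ ^ 2 * (p.gain m i i + p.gain m j j - p.gain m i j - p.gain m j i)

variable {p}

theorem d_pos (hσ : 0 < p.σ) (i : Fin K) : 0 < p.d m i := by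
  unfold d; positivity

theorem armCov_symm (hS : p.S.PosDef) (i j : Fin K) : p.armCov i j = p.armCov j i := by
  have hT : p.Sᵀ = p.S := by simpa using hS.isHermitian.eq
  have : p.b i ⬝ᵥ (p.S *ᵥ p.b j) = p.b j ⬝ᵥ (p.S *ᵥ p.b i) := by
    rw [dotProduct_mulVec, ← mulVec_transpose, hT, dotProduct_comm]
  simp only [armCov, of_apply, this]
  by_cases h : i = j
  · simp [h]
  · simp [h, Ne.symm h]

theorem posDef_precision (hS : p.S.PosDef) (hσ : 0 < p.σ) :
    (p.S⁻¹ + ∑ k, ((m k : ℝ) / (m k * p.σ₀ k ^ 2 + p.σ ^ 2)) •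
      vecMulVec (p.b k) (p.b k)).PosDef := by
  refine hS.inv.add_posSemidef (posSemidef_sum _ fun k _ => PosSemidef.smul ?_ (by positivity))
  simpa using posSemidef_vecMulVec_self_star (p.b k)

theorem posDef_effectCov (hS : p.S.PosDef) (hσ : 0 < p.σ) : (p.effectCov m).PosDef :=
  (posDef_precision m hS hσ).inv

theorem g_symm (hS : p.S.PosDef) (hσ : 0 < p.σ) (i j : Fin K) : p.g m i j = p.g m j i := by
  have hT : (p.effectCov m)ᵀ = p.effectCov m := by
    simpa using (posDef_effectCov m hS hσ).isHermitian.eq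
  unfold g
  rw [dotProduct_mulVec, ← mulVec_transpose, hT, dotProduct_comm]

/-- This is `effectCov * precision = 1` multiplied on the right by `S`, which removes the inverse
matrices from the later computations. -/
theorem effectCov_mul (hS : p.S.PosDef) (hσ : 0 < p.σ) :
    p.effectCov m * (∑ k, ((m k : ℝ) / p.d m k) • vecMulVec (p.b k) (p.b k)) * p.S
      + p.effectCov m = p.S := by
  have h1 := Matrix.nonsing_inv_mul _ ((posDef_precision m hS hσ).det_pos.ne'.isUnit)
  have h2 := Matrix.nonsing_inv_mul p.S hS.det_pos.ne'.isUnit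
  change p.effectCov m * _ = 1 at h1
  rw [Matrix.mul_add] at h1
  calc _ = (p.effectCov m * p.S⁻¹ + p.effectCov m *
        (∑ k, ((m k : ℝ) / p.d m k) • vecMulVec (p.b k) (p.b k))) * p.S := by
        rw [add_mul, Matrix.mul_assoc _ p.S⁻¹, h2, Matrix.mul_one, add_comm]
    _ = p.S := by unfold d; rw [h1, Matrix.one_mul]

theorem sum_g_mul (hS : p.S.PosDef) (hσ : 0 < p.σ) (i k : Fin K) :
    ∑ l, p.g m l i / p.d m l * (m l * (p.b l ⬝ᵥ (p.S *ᵥ p.b k))) + p.g m k i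
      = p.b i ⬝ᵥ (p.S *ᵥ p.b k) := by
  have h := congrArg (fun M => p.b i ⬝ᵥ (M *ᵥ p.b k)) (effectCov_mul m hS hσ)
  simp only [add_mulVec, dotProduct_add, ← mulVec_mulVec, sum_mulVec, smul_mulVec,
    vecMulVec_mulVec, mulVec_sum, mulVec_smul, dotProduct_sum, dotProduct_smul] at h
  rw [← h, g_symm m hS hσ k i]
  congr 1
  refine Finset.sum_congr rfl fun l _ => ?_
  rw [g_symm m hS hσ l i]
  simp [g]
  ring

/-- The normal equations for the linear prediction of the mean rewards from the rewards. -/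
theorem gain_normal_eq (hS : p.S.PosDef) (hσ : 0 < p.σ) (i k : Fin K) :
    ∑ l, p.gain m i l * (m l * p.armCov l k) + p.σ ^ 2 * p.gain m i k = p.armCov i k := by
  have hd := d_pos m hσ
  have hi := (hd i).ne'
  -- Both `gain` and `armCov` are a diagonal part plus a part through the effects. After expansion
  -- only the effects-effects product keeps a genuine sum over `l`, and `sum_g_mul` evaluates it.
  have e : ∀ l, p.gain m i l * (m l * p.armCov l k) =
      (if i = l then p.σ₀ i ^ 2 / p.d m i * (m i * p.armCov i k) else 0)
      + p.σ ^ 2 / p.d m i * (p.g m l i / p.d m l * (m l * (p.b l ⬝ᵥ (p.S *ᵥ p.b k))))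
      + (if l = k then p.σ ^ 2 / p.d m i * (p.g m k i / p.d m k * (m k * p.σ₀ k ^ 2)) else 0) := by
    intro l
    simp only [gain, armCov, of_apply]
    by_cases h1 : i = l <;> by_cases h2 : l = k <;> (try subst h1) <;> (try subst h2) <;>
      simp [*] <;> ring
  simp_rw [e, Finset.sum_add_distrib, ← Finset.mul_sum]
  rw [eq_sub_of_add_eq (sum_g_mul m hS hσ i k)]
  simp only [Finset.sum_ite_eq, Finset.sum_ite_eq', Finset.mem_univ, if_true]
  have hk := (hd k).ne'
  by_cases h : i = k
  · subst h
    simp only [gain, armCov, of_apply, if_true]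
    field_simp
    unfold d
    ring
  · simp only [gain, armCov, of_apply, h, if_false]
    field_simp
    unfold d
    ring

/-- The right side is the variance of the prediction error (`covariance_predErr`), so this links the
closed form to the model. -/
theorem margVar_eq (hσ₀ : ∀ i, 0 < p.σ₀ i) (hσ : 0 < p.σ) (i : Fin K) :
    p.margVar m i = p.σ ^ 2 * p.gain m i i := by
  have h1 := (hσ₀ i).ne'
  have hi := (d_pos (p := p) m hσ i).ne'
  have : p.condVar m i = p.σ ^ 2 * p.σ₀ i ^ 2 / p.d m i := by
    unfold condVar
    rw [inv_eq_iff_eq_inv, inv_div]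
    unfold d
    field_simp
    ring
  simp only [margVar, this, gain, if_true]
  field_simp

theorem covB_eq (i j : Fin K) :
    p.covB m i j = m i * p.armCov i j * m j + if i = j then p.σ ^ 2 * m i else 0 := by
  unfold covB armCov
  by_cases h : i = j
  · subst h; simp; ring
  · simp [h]; ring

/-- With `N` the diagonal matrix of the pulls, `covB = (N * armCov + σ² I) * N`, so these are the
normal equations multiplied by `N`. -/
theorem sum_gain_covB (hS : p.S.PosDef) (hσ : 0 < p.σ) (i k : Fin K) :
    ∑ l, p.gain m i l * p.covB m l k = p.armCov i k * m k := by
  rw [← gain_normal_eq m hS hσ i k, add_mul, Finset.sum_mul]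
  simp_rw [covB_eq, mul_add, Finset.sum_add_distrib]
  congr 1
  · exact Finset.sum_congr rfl fun l _ => by ring
  · simp; ring

theorem sum_gain_covB_gain (hS : p.S.PosDef) (hσ : 0 < p.σ) (i j : Fin K) :
    ∑ k, ∑ k', p.gain m i k * p.gain m j k' * p.covB m k k'
      = p.armCov i j - p.σ ^ 2 * p.gain m j i := by
  rw [Finset.sum_comm, armCov_symm hS i j, ← gain_normal_eq m hS hσ j i, add_sub_cancel_right]
  refine Finset.sum_congr rfl fun l _ => ?_
  rw [armCov_symm hS l i, mul_comm (m l : ℝ), ← sum_gain_covB m hS hσ i l, Finset.mul_sum]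
  exact Finset.sum_congr rfl fun k _ => by ring

theorem covB_symm (hS : p.S.PosDef) (i j : Fin K) : p.covB m i j = p.covB m j i := by
  rw [covB_eq, covB_eq, armCov_symm hS i j]
  by_cases h : i = j
  · simp [h]
  · simp [h, Ne.symm h]; ring

/-- Each `gain` has two summands, so the bilinear form splits into four terms; they are the building
blocks of the definition of `c`. -/
theorem gain_form_expand (hS : p.S.PosDef) (i j : Fin K) :
    ∑ k, ∑ k', p.gain m i k * p.gain m j k' * p.covB m k k' =
      p.σ₀ i ^ 2 * p.σ₀ j ^ 2 / (p.d m i * p.d m j) * p.covB m i j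
      + p.σ ^ 4 / (p.d m i * p.d m j) *
        ∑ k, ∑ k', p.g m k i * p.g m k' j / (p.d m k * p.d m k') * p.covB m k k'
      + p.σ ^ 2 * p.σ₀ j ^ 2 / (p.d m i * p.d m j) * ∑ k, p.g m k i / p.d m k * p.covB m k j
      + p.σ ^ 2 * p.σ₀ i ^ 2 / (p.d m i * p.d m j) *
        ∑ k, p.g m k j / p.d m k * p.covB m k i := by
  have e : ∀ k k', p.gain m i k * p.gain m j k' * p.covB m k k' =
      (if i = k then if j = k' then
        p.σ₀ i ^ 2 * p.σ₀ j ^ 2 / (p.d m i * p.d m j) * p.covB m i j else 0 else 0)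
      + p.σ ^ 4 / (p.d m i * p.d m j) *
        (p.g m k i * p.g m k' j / (p.d m k * p.d m k') * p.covB m k k')
      + (if j = k' then
        p.σ ^ 2 * p.σ₀ j ^ 2 / (p.d m i * p.d m j) * (p.g m k i / p.d m k * p.covB m k j) else 0)
      + (if i = k then p.σ ^ 2 * p.σ₀ i ^ 2 / (p.d m i * p.d m j) *
        (p.g m k' j / p.d m k' * p.covB m k' i) else 0) := by
    intro k k'
    by_cases h1 : i = k
    · by_cases h2 : j = k'
      · subst h1 h2; simp only [gain, if_true, covB_symm m hS j i]; ring
      · subst h1; simp only [gain, if_true, h2, if_false, covB_symm m hS k' i]; ring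
    · by_cases h2 : j = k'
      · subst h2; simp only [gain, if_true, h1, if_false]; ring
      · simp only [gain, h1, h2, if_false]; ring
  simp_rw [e, Finset.sum_add_distrib, ← Finset.mul_sum]
  simp [← Finset.mul_sum]

theorem gapVar_eq {i j : Fin K} (h : i ≠ j) :
    p.gapVar i j = p.armCov i i + p.armCov j j - p.armCov i j - p.armCov j i := by
  simp only [gapVar, armCov, of_apply, mulVec_sub, sub_dotProduct, dotProduct_sub, h, h.symm,
    if_true, if_false]
  ring

theorem c_eq (hS : p.S.PosDef) (hσ : 0 < p.σ) (i j : Fin K) :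
    p.c m i j = p.armCov i i + p.armCov j j - p.armCov i j - p.armCov j i - p.postVar m i j := by
  have h : p.c m i j = ∑ k, ∑ k', p.gain m i k * p.gain m i k' * p.covB m k k'
      + ∑ k, ∑ k', p.gain m j k * p.gain m j k' * p.covB m k k'
      - 2 * ∑ k, ∑ k', p.gain m i k * p.gain m j k' * p.covB m k k' := by
    simp_rw [gain_form_expand m hS]
    unfold c
    ring
  -- One of the two cross terms is transposed, so that `gain i j` and `gain j i` each appear once,
  -- as in `postVar`.
  have hji : ∑ k, ∑ k', p.gain m i k * p.gain m j k' * p.covB m k k'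
      = ∑ k, ∑ k', p.gain m j k * p.gain m i k' * p.covB m k k' := by
    rw [Finset.sum_comm]
    exact Finset.sum_congr rfl fun k _ => Finset.sum_congr rfl fun k' _ => by
      rw [covB_symm m hS]; ring
  rw [h, two_mul]
  nth_rw 2 [hji]
  simp_rw [sum_gain_covB_gain m hS hσ]
  unfold postVar
  ring

/-- The law of total variance for `θ i - θ j`. It makes the exponent of the final bound free of `n`.
-/
theorem c_add_postVar (hS : p.S.PosDef) (hσ : 0 < p.σ) {i j : Fin K} (h : i ≠ j) :
    p.c m i j + p.postVar m i j = p.gapVar i j := by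
  rw [c_eq m hS hσ, gapVar_eq h]; ring

theorem g_self_nonneg (hS : p.S.PosDef) (hσ : 0 < p.σ) (i : Fin K) : 0 ≤ p.g m i i := by
  simpa [g] using (posDef_effectCov m hS hσ).posSemidef.dotProduct_mulVec_nonneg (p.b i)

theorem quad_g_nonneg (hS : p.S.PosDef) (hσ : 0 < p.σ) (i j : Fin K) (x y : ℝ) :
    0 ≤ x ^ 2 * p.g m i i + y ^ 2 * p.g m j j + 2 * (x * y) * p.g m i j := by
  have h := (posDef_effectCov m hS hσ).posSemidef.dotProduct_mulVec_nonneg (x • p.b i + y • p.b j)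
  simp only [star_trivial, mulVec_add, mulVec_smul, add_dotProduct, dotProduct_add,
    smul_dotProduct, dotProduct_smul, smul_eq_mul] at h
  change 0 ≤ x * (x * p.g m i i + y * p.g m j i) +
    y * (x * p.g m i j + y * p.g m j j) at h
  rw [g_symm m hS hσ j i] at h
  linarith

theorem margVar_pos (hS : p.S.PosDef) (hσ₀ : ∀ i, 0 < p.σ₀ i) (hσ : 0 < p.σ) (i : Fin K) :
    0 < p.margVar m i := by
  have h1 := hσ₀ i
  have hi := d_pos (p := p) m hσ i
  have := g_self_nonneg m hS hσ i
  rw [margVar_eq m hσ₀ hσ]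
  simp only [gain, if_true]
  positivity

theorem postVar_eq (hS : p.S.PosDef) (hσ : 0 < p.σ) {i j : Fin K} (h : i ≠ j) :
    p.postVar m i j = p.σ ^ 2 * (p.σ₀ i ^ 2 / p.d m i + p.σ₀ j ^ 2 / p.d m j) + p.σ ^ 4 *
      ((1 / p.d m i) ^ 2 * p.g m i i + (1 / p.d m j) ^ 2 * p.g m j j
        - 2 * (1 / p.d m i * (1 / p.d m j)) * p.g m i j) := by
  simp only [postVar, gain, h, h.symm, if_true, if_false, g_symm m hS hσ j i]
  ring

theorem postVar_pos (hS : p.S.PosDef) (hσ₀ : ∀ i, 0 < p.σ₀ i) (hσ : 0 < p.σ) {i j : Fin K}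
    (h : i ≠ j) : 0 < p.postVar m i j := by
  have h1 := hσ₀ i
  have h2 := hσ₀ j
  have hi := d_pos (p := p) m hσ i
  have hj := d_pos (p := p) m hσ j
  rw [postVar_eq m hS hσ h]
  have := quad_g_nonneg m hS hσ i j (1 / p.d m i) (-(1 / p.d m j))
  refine add_pos_of_pos_of_nonneg (by positivity) (mul_nonneg (by positivity) ?_)
  linarith

/-- The shared effects correlate the two posteriors, so the variance of the difference may exceed
the sum of the variances, but not twice the sum: the slack contains the same quadratic form in `g`
with a plus sign, which is nonnegative. -/
theorem postVar_le (hS : p.S.PosDef) (hσ₀ : ∀ i, 0 < p.σ₀ i) (hσ : 0 < p.σ) {i j : Fin K}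
    (h : i ≠ j) : p.postVar m i j ≤ 2 * (p.margVar m i + p.margVar m j) := by
  have h1 := hσ₀ i
  have h2 := hσ₀ j
  have hi := d_pos (p := p) m hσ i
  have hj := d_pos (p := p) m hσ j
  rw [postVar_eq m hS hσ h, margVar_eq m hσ₀ hσ, margVar_eq m hσ₀ hσ]
  have h3 := mul_nonneg (by positivity : 0 ≤ p.σ ^ 4)
    (quad_g_nonneg m hS hσ i j (1 / p.d m i) (1 / p.d m j))
  have h4 : 0 ≤ p.σ ^ 2 * (p.σ₀ i ^ 2 / p.d m i + p.σ₀ j ^ 2 / p.d m j) := by positivity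
  simp only [gain, if_true]
  ring_nf at h3 h4 ⊢
  linarith

/-- Data cannot increase the covariance of the effects. With `x = effectCov b`, the precision
dominates `S⁻¹`, so `xᵀS⁻¹x ≤ bᵀx`; expanding `0 ≤ (x - Sb)ᵀS⁻¹(x - Sb)` gives `2bᵀx ≤ xᵀS⁻¹x +
bᵀSb`. -/
theorem g_self_le (hS : p.S.PosDef) (hσ : 0 < p.σ) (i : Fin K) :
    p.g m i i ≤ p.b i ⬝ᵥ (p.S *ᵥ p.b i) := by
  obtain ⟨x, hx⟩ : ∃ x, x = p.effectCov m *ᵥ p.b i := ⟨_, rfl⟩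
  have hT : p.Sᵀ = p.S := by simpa using hS.isHermitian.eq
  have hSS : p.S⁻¹ * p.S = 1 := Matrix.nonsing_inv_mul p.S hS.det_pos.ne'.isUnit
  have hSS' : p.S * p.S⁻¹ = 1 := Matrix.mul_nonsing_inv p.S hS.det_pos.ne'.isUnit
  have hg : p.g m i i = p.b i ⬝ᵥ x := by rw [hx]; rfl
  have hprec : (p.S⁻¹ + ∑ k, ((m k : ℝ) / (m k * p.σ₀ k ^ 2 + p.σ ^ 2)) •
      vecMulVec (p.b k) (p.b k)) *ᵥ x = p.b i := by
    rw [hx, mulVec_mulVec]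
    unfold effectCov
    rw [Matrix.mul_nonsing_inv _ ((posDef_precision m hS hσ).det_pos.ne'.isUnit), one_mulVec]
  have h1 : x ⬝ᵥ (p.S⁻¹ *ᵥ x) ≤ p.b i ⬝ᵥ x := by
    rw [dotProduct_comm _ x, ← hprec, add_mulVec, dotProduct_add, le_add_iff_nonneg_right]
    have : (∑ k, ((m k : ℝ) / (m k * p.σ₀ k ^ 2 + p.σ ^ 2)) •
      vecMulVec (p.b k) (p.b k)).PosSemidef := by
      refine posSemidef_sum _ fun k _ => PosSemidef.smul ?_ (by positivity)
      simpa using posSemidef_vecMulVec_self_star (p.b k)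
    simpa using this.dotProduct_mulVec_nonneg x
  have h2 : 0 ≤ (x - p.S *ᵥ p.b i) ⬝ᵥ (p.S⁻¹ *ᵥ (x - p.S *ᵥ p.b i)) := by
    simpa using hS.inv.posSemidef.dotProduct_mulVec_nonneg (x - p.S *ᵥ p.b i)
  have h3 : (p.S *ᵥ p.b i) ⬝ᵥ (p.S⁻¹ *ᵥ x) = p.b i ⬝ᵥ x := by
    rw [← vecMul_transpose p.S, hT, ← dotProduct_mulVec,
      mulVec_mulVec, hSS', one_mulVec]
  rw [mulVec_sub, mulVec_mulVec _ p.S⁻¹ p.S, hSS, one_mulVec, sub_dotProduct, dotProduct_sub, dotProduct_sub,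
    h3, ← hg, dotProduct_comm (p.S *ᵥ p.b i), dotProduct_comm x (p.b i)] at h2
  linarith

theorem margVar_le (hS : p.S.PosDef) (hσ₀ : ∀ i, 0 < p.σ₀ i) (hσ : 0 < p.σ) (i : Fin K) :
    p.margVar m i ≤ p.σ ^ 2 / p.d m i * (p.σ₀ i ^ 2 + p.b i ⬝ᵥ (p.S *ᵥ p.b i)) := by
  have hi := d_pos (p := p) m hσ i
  have h1 := g_self_nonneg m hS hσ i
  have h2 := g_self_le m hS hσ i
  have h3 : p.σ ^ 2 / p.d m i ≤ 1 := by
    rw [div_le_one hi]; unfold d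
    have : 0 ≤ (m i : ℝ) * p.σ₀ i ^ 2 := by positivity
    linarith
  have h4 : p.margVar m i =
      p.σ ^ 2 / p.d m i * (p.σ₀ i ^ 2 + p.σ ^ 2 / p.d m i * p.g m i i) := by
    rw [margVar_eq m hσ₀ hσ]; simp only [gain, if_true]; ring
  rw [h4]
  gcongr
  nlinarith

theorem condVar_le_margVar (hS : p.S.PosDef) (hσ : 0 < p.σ) (i : Fin K) :
    p.condVar m i ≤ p.margVar m i := by
  have h1 := g_self_nonneg m hS hσ i
  unfold margVar
  have : 0 ≤ p.condVar m i ^ 2 / p.σ₀ i ^ 4 * p.g m i i := by positivity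
  linarith

end HierParams

/-! ### One-dimensional Gaussian estimates. -/

open scoped NNReal ENNReal

theorem gaussianReal_Iic_mean (a : ℝ) {v : ℝ≥0} (hv : v ≠ 0) :
    gaussianReal a v (Set.Iic a) = 2⁻¹ := by
  have := nullSingletonClass_gaussianReal (μ := 0) hv
  have h0 : gaussianReal a v (Set.Iic a) = gaussianReal 0 v (Set.Iic 0) := by
    have := gaussianReal_map_const_add (μ := 0) (v := v) a
    rw [zero_add] at this
    rw [← this, Measure.map_apply (by fun_prop) measurableSet_Iic]
    congr 1
    ext x; simp
  have h1 : gaussianReal 0 v (Set.Iic 0) = gaussianReal 0 v (Set.Ioi 0) := by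
    have := gaussianReal_map_neg (μ := 0) (v := v)
    rw [neg_zero] at this
    nth_rw 1 [← this]
    rw [Measure.map_apply (by fun_prop) measurableSet_Iic, ← measure_congr Ioi_ae_eq_Ici.symm]
    congr 1
    ext x; simp
  have h2 := measure_add_measure_compl (μ := gaussianReal 0 v) (measurableSet_Iic (a := (0 : ℝ)))
  rw [Set.compl_Iic, ← h1, measure_univ, ← two_mul] at h2
  rw [h0]
  exact ENNReal.eq_inv_of_mul_eq_one_left (by rwa [mul_comm])

/-- For `x ≤ -a` one has `(x + a)² + a² ≤ x²`, so the density is at most `exp(-a²/(2v))` times that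
of `N(-a, v)`, which puts mass `1/2` on this half-line. The factor `1/2` is needed later. -/
theorem gaussianReal_Iic_neg_le {v : ℝ≥0} (hv : v ≠ 0) {a : ℝ} (ha : 0 ≤ a) :
    gaussianReal 0 v (Set.Iic (-a)) ≤ 2⁻¹ * ENNReal.ofReal (Real.exp (-a ^ 2 / (2 * v))) := by
  have hv' : (0 : ℝ) < v := by positivity
  rw [← gaussianReal_Iic_mean (-a) hv, gaussianReal_apply _ hv, gaussianReal_apply _ hv,
    ← lintegral_mul_const _ (by fun_prop)]
  refine setLIntegral_mono (by fun_prop) fun x hx => ?_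
  simp only [gaussianPDF, gaussianPDFReal]
  rw [← ENNReal.ofReal_mul (by positivity)]
  refine ENNReal.ofReal_le_ofReal ?_
  rw [mul_assoc (Real.sqrt _)⁻¹, ← Real.exp_add]
  refine mul_le_mul_of_nonneg_left (Real.exp_le_exp.2 ?_) (by positivity)
  rw [← add_div]
  refine div_le_div_of_nonneg_right ?_ (by positivity)
  have : x ≤ -a := hx
  nlinarith

theorem lintegral_exp_neg_sq_gaussianReal (δ : ℝ) {v : ℝ≥0} (hv : v ≠ 0) (c : ℝ≥0) :
    ∫⁻ y, ENNReal.ofReal (Real.exp (-y ^ 2 / (2 * v))) ∂gaussianReal δ c =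
      ENNReal.ofReal (Real.sqrt (v / (v + c)) * Real.exp (-δ ^ 2 / (2 * (v + c)))) := by
  have hv' : (0 : ℝ) < v := by positivity
  -- Zero variance, as when no arm is pulled, has no density and is treated as a point mass.
  by_cases hc : c = 0
  · subst hc
    simp [hv'.ne']
  have hc' : (0 : ℝ) < c := by positivity
  have hw : v * c / (v + c) ≠ 0 := by positivity
  rw [gaussianReal_of_var_ne_zero _ hc, lintegral_withDensity_eq_lintegral_mul _ (by fun_prop)
    (by fun_prop)]
  have : ∀ y, (gaussianPDF δ c * fun y => ENNReal.ofReal (Real.exp (-y ^ 2 / (2 * v)))) y =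
      ENNReal.ofReal (Real.sqrt (v / (v + c)) * Real.exp (-δ ^ 2 / (2 * (v + c)))) *
        gaussianPDF (δ * v / (v + c)) (v * c / (v + c)) y := by
    intro y
    simp only [Pi.mul_apply, gaussianPDF, gaussianPDFReal]
    rw [← ENNReal.ofReal_mul (by positivity), ← ENNReal.ofReal_mul (by positivity)]
    congr 1
    have e1 : Real.sqrt (2 * Real.pi * (v * c / (v + c) : ℝ≥0)) =
        Real.sqrt (2 * Real.pi * c) * Real.sqrt (v / (v + c)) := by
      rw [← Real.sqrt_mul (by positivity)]
      congr 1
      push_cast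
      ring
    have h0 : Real.sqrt (v / (v + c)) ≠ 0 := by positivity
    rw [e1, mul_inv, mul_assoc, ← Real.exp_add]
    -- Completing the square in `y`: the product is a constant times another Gaussian density.
    have e2 : -(y - δ) ^ 2 / (2 * (c : ℝ)) + -y ^ 2 / (2 * v) = -δ ^ 2 / (2 * (v + c)) +
        -(y - δ * v / (v + c)) ^ 2 / (2 * (v * c / (v + c) : ℝ≥0)) := by
      push_cast
      field_simp
      ring
    rw [e2, Real.exp_add]
    field_simp
  simp_rw [this]
  rw [lintegral_const_mul' _ _ ENNReal.ofReal_ne_top, lintegral_gaussianPDF_eq_one _ hw, mul_one]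

/-- The probability that an independent centered Gaussian error turns a nonnegative Gaussian
variable into a nonpositive one. -/
theorem prod_gaussianReal_sign_error_le (δ : ℝ) {v : ℝ≥0} (hv : v ≠ 0) (c : ℝ≥0) :
    ((gaussianReal 0 v).prod (gaussianReal δ c)) {q | 0 ≤ q.2 ∧ q.1 + q.2 ≤ 0} ≤
      ENNReal.ofReal
        (2⁻¹ * (Real.sqrt (v / (v + c)) * Real.exp (-δ ^ 2 / (2 * (v + c))))) := by
  have hm : MeasurableSet {q : ℝ × ℝ | 0 ≤ q.2 ∧ q.1 + q.2 ≤ 0} :=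
    (measurableSet_le measurable_const measurable_snd).inter
      (measurableSet_le (measurable_fst.add measurable_snd) measurable_const)
  have h2 : ENNReal.ofReal 2⁻¹ = 2⁻¹ := by
    rw [ENNReal.ofReal_inv_of_pos two_pos, ENNReal.ofReal_ofNat]
  rw [Measure.prod_apply_symm hm, ENNReal.ofReal_mul (by positivity), h2,
    ← lintegral_exp_neg_sq_gaussianReal δ hv c, ← lintegral_const_mul _
    (by fun_prop : Measurable fun y : ℝ => ENNReal.ofReal (Real.exp (-y ^ 2 / (2 * v))))]
  refine lintegral_mono fun y => ?_
  by_cases hy : 0 ≤ y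
  · refine (measure_mono fun x hx => ?_).trans (gaussianReal_Iic_neg_le hv hy)
    have : x + y ≤ 0 := hx.2
    simp only [Set.mem_Iic]
    linarith
  · have : (fun x => (x, y)) ⁻¹' {q : ℝ × ℝ | 0 ≤ q.2 ∧ q.1 + q.2 ≤ 0} = ∅ := by
      ext x; simp [hy]
    rw [this]; simp

/-- After squaring, the claim is `v (M + c) ≤ 4 M (v + c)`, and `v c ≤ 2 M c` suffices. -/
theorem half_sqrt_le_inv_sqrt {v c M : ℝ} (hv : 0 < v) (hc : 0 ≤ c) (hM : 0 < M)
    (hvM : v ≤ 2 * M) : 2⁻¹ * Real.sqrt (v / (v + c)) ≤ 1 / Real.sqrt (1 + c / M) := by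
  rw [le_div_iff₀ (by positivity), mul_assoc, ← Real.sqrt_mul (by positivity)]
  have : Real.sqrt (v / (v + c) * (1 + c / M)) ≤ 2 := by
    rw [Real.sqrt_le_left (by positivity)]
    have : v / (v + c) * (1 + c / M) = v * (M + c) / ((v + c) * M) := by field_simp
    rw [this, div_le_iff₀ (by positivity)]
    nlinarith [mul_pos hv hM, mul_nonneg hc hM.le, mul_nonneg (sub_nonneg.2 hvM) hc]
  linarith

theorem one_div_sqrt_one_add_div_le {c M : ℝ} (hc : 0 < c) (hM : 0 < M) :
    1 / Real.sqrt (1 + c / M) ≤ Real.sqrt (M / c) := by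
  rw [div_le_iff₀ (by positivity), ← Real.sqrt_mul (by positivity), Real.one_le_sqrt]
  rw [mul_add, mul_one, div_mul_div_cancel₀ hc.ne', div_self hM.ne']
  have : 0 < M / c := by positivity
  linarith

/-! ### Residuals of conditionally Gaussian variables and products of Gaussian laws. -/

/-- Variables with independent conditional laws `N(f u i, v i)` given `u` have centered Gaussian
residuals that are independent of the conditioning. -/
theorem hasLaw_prodMk_residual {Ω X ι : Type*} [MeasurableSpace Ω] [MeasurableSpace X] [Fintype ι]
    {P : Measure Ω} [IsProbabilityMeasure P] {U : Ω → X} {W : Ω → ι → ℝ} {κ : Kernel X (ι → ℝ)}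
    {f : X → ι → ℝ} (hf : Measurable f) {v : ι → ℝ≥0}
    (hκ : ∀ x, κ x = Measure.pi fun i => gaussianReal (f x i) (v i))
    (h : HasCondDistrib W U κ P) :
    HasLaw (fun ω => (U ω, W ω - f (U ω)))
      ((P.map U).prod (Measure.pi fun i => gaussianReal 0 (v i))) P := by
  have hM : IsMarkovKernel κ := ⟨fun x => by rw [hκ]; infer_instance⟩
  have hU : AEMeasurable U P := h.aemeasurable_fst
  have : IsProbabilityMeasure (P.map U) := Measure.isProbabilityMeasure_map hU
  have hs : Measurable fun q : X × (ι → ℝ) => (q.1, q.2 - f q.1) := by fun_prop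
  have hL : HasLaw (fun q : X × (ι → ℝ) => (q.1, q.2 - f q.1))
      ((P.map U).prod (Measure.pi fun i => gaussianReal 0 (v i))) ((P.map U) ⊗ₘ κ) := by
    refine ⟨hs.aemeasurable, ?_⟩
    ext s hs'
    rw [Measure.map_apply hs hs', Measure.compProd_apply (hs hs'), Measure.prod_apply hs']
    refine lintegral_congr fun x => ?_
    have hx : (κ x).map (fun w => w - f x) = Measure.pi fun i => gaussianReal 0 (v i) := by
      have := Measure.pi_map_pi (μ := fun i => gaussianReal (f x i) (v i))
        (f := fun i (y : ℝ) => y - f x i) (fun i => by fun_prop)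
      simp only [gaussianReal_map_sub_const, sub_self] at this
      rw [hκ]
      exact this
    rw [← hx, Measure.map_apply (by fun_prop) (measurable_prodMk_left hs')]
    rfl
  exact hL.comp h

/-- A product of Gaussian laws is Gaussian. -/
instance isGaussian_pi_gaussianReal {ι : Type*} [Fintype ι] (a : ι → ℝ) (v : ι → ℝ≥0) :
    IsGaussian (Measure.pi fun i => gaussianReal (a i) (v i)) := by
  have h := iIndepFun.hasGaussianLaw (P := Measure.pi fun i => gaussianReal (a i) (v i))
    (X := fun i (x : ι → ℝ) => x i)
    (fun i => (measurePreserving_eval (fun i => gaussianReal (a i) (v i)) i).hasLaw.hasGaussianLaw)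
    (iIndepFun_pi (X := fun i => id) (fun i => aemeasurable_id))
  have h2 := h.isGaussian_map
  rwa [show (fun (x : ι → ℝ) i => x i) = id from rfl, Measure.map_id] at h2

theorem covariance_eval_pi_gaussianReal {ι : Type*} [Fintype ι] [DecidableEq ι] (a : ι → ℝ)
    (v : ι → ℝ≥0) (i j : ι) :
    cov[fun x => x i, fun x => x j; Measure.pi fun i => gaussianReal (a i) (v i)] =
      if i = j then (v i : ℝ) else 0 := by
  have hg : HasGaussianLaw (fun x : ι → ℝ => (x ·)) (Measure.pi fun i => gaussianReal (a i) (v i)) :=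
    IsGaussian.hasGaussianLaw_id
  split_ifs with h
  · subst h
    rw [covariance_self (measurable_pi_apply i).aemeasurable,
      (measurePreserving_eval (fun i => gaussianReal (a i) (v i)) i).hasLaw.variance_eq,
      variance_id_gaussianReal]
  · have hi := iIndepFun_pi (μ := fun i => gaussianReal (a i) (v i)) (X := fun i => id)
      (fun i => aemeasurable_id)
    exact (hi.indepFun h).covariance_eq_zero (hg.eval i).memLp_two (hg.eval j).memLp_two

/-! ### Joint Gaussianity and second moments of the model. -/

namespace IsHierBandit

variable {K L T : ℕ} {p : HierParams K L} {A : Fin T → Fin K} {Ω : Type u} [MeasurableSpace Ω]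
  {P : Measure Ω} {μ : Ω → EuclideanSpace ℝ (Fin L)} {θ : Ω → Fin K → ℝ} {Y : Ω → Fin T → ℝ}

/-- The deviations of the mean rewards from their conditional means given the effects. -/
abbrev armNoise (p : HierParams K L) (μ : Ω → EuclideanSpace ℝ (Fin L)) (θ : Ω → Fin K → ℝ) :
    Ω → Fin K → ℝ := fun x => θ x - fun i => p.b i ⬝ᵥ (μ x).ofLp

/-- The deviations of the rewards from the mean rewards of the arms. -/
abbrev rewardNoise (A : Fin T → Fin K) (θ : Ω → Fin K → ℝ) (Y : Ω → Fin T → ℝ) :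
    Ω → Fin T → ℝ := fun x => Y x - fun t => θ x (A t)

theorem covariance_effects (h : IsHierBandit p A P μ θ Y) (hS : p.S.PosSemidef) (b b' : Fin L → ℝ) :
    cov[fun x => b ⬝ᵥ (μ x).ofLp, fun x => b' ⬝ᵥ (μ x).ofLp; P] = b ⬝ᵥ (p.S *ᵥ b') := by
  have e : ∀ b : Fin L → ℝ, (fun x => b ⬝ᵥ (μ x).ofLp) =
      (fun y => inner ℝ (WithLp.toLp 2 b) y) ∘ μ := fun b => by
    ext x; simp [PiLp.inner_apply, dotProduct, mul_comm]
  rw [e, e, h.law_effects.covariance_comp (by fun_prop) (by fun_prop),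
    ← covarianceBilin_apply_eq_cov IsGaussian.memLp_two_id,
    covarianceBilin_multivariateGaussian hS]

theorem memLp_effects (h : IsHierBandit p A P μ θ Y) (b : Fin L → ℝ) :
    MemLp (fun x => b ⬝ᵥ (μ x).ofLp) 2 P := by
  have e : (fun x => b ⬝ᵥ (μ x).ofLp) =
      (fun y => inner ℝ (WithLp.toLp 2 b) y) ∘ μ := by
    ext x; simp [PiLp.inner_apply, dotProduct, mul_comm]
  rw [e]
  exact (h.law_effects.hasGaussianLaw.map (innerSL ℝ (WithLp.toLp 2 b))).memLp_two

theorem reward_eq {α : Type*} (A : Fin T → Fin K) (θ : α → Fin K → ℝ) (Y : α → Fin T → ℝ)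
    (t : Fin T) :
    (fun x => Y x t) = (fun x => θ x (A t)) + fun x => rewardNoise A θ Y x t := by
  ext x
  change Y x t = θ x (A t) + (Y x t - θ x (A t))
  ring

variable [IsProbabilityMeasure P]

theorem hasLaw_armNoise (h : IsHierBandit p A P μ θ Y) :
    HasLaw (fun x => (μ x, armNoise p μ θ x))
      ((multivariateGaussian (WithLp.toLp 2 p.ν) p.S).prod
        (Measure.pi fun i => gaussianReal 0 (Real.toNNReal (p.σ₀ i ^ 2)))) P := by
  rw [← h.law_effects.map_eq]
  exact hasLaw_prodMk_residual (f := fun (m : EuclideanSpace ℝ (Fin L)) i => p.b i ⬝ᵥ m.ofLp)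
    (by unfold dotProduct; fun_prop) (fun _ => rfl) h.law_means

theorem hasLaw_rewardNoise (h : IsHierBandit p A P μ θ Y) :
    HasLaw (fun x => ((μ x, θ x), rewardNoise A θ Y x))
      ((P.map fun x => (μ x, θ x)).prod
        (Measure.pi fun _ => gaussianReal 0 (Real.toNNReal (p.σ ^ 2)))) P :=
  hasLaw_prodMk_residual (f := fun (q : EuclideanSpace ℝ (Fin L) × (Fin K → ℝ)) t => q.2 (A t))
    (by fun_prop) (fun _ => rfl) h.law_rewards

theorem hasLaw_armNoise_snd (h : IsHierBandit p A P μ θ Y) :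
    HasLaw (armNoise p μ θ)
      (Measure.pi fun i => gaussianReal 0 (Real.toNNReal (p.σ₀ i ^ 2))) P :=
  (measurePreserving_snd.hasLaw).comp h.hasLaw_armNoise

theorem hasLaw_rewardNoise_snd (h : IsHierBandit p A P μ θ Y) :
    HasLaw (rewardNoise A θ Y)
      (Measure.pi fun _ => gaussianReal 0 (Real.toNNReal (p.σ ^ 2))) P := by
  have : IsProbabilityMeasure (P.map fun x => (μ x, θ x)) :=
    Measure.isProbabilityMeasure_map (h.measurable_effects.prodMk h.measurable_means).aemeasurable
  exact (measurePreserving_snd.hasLaw).comp h.hasLaw_rewardNoise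

theorem indepFun_armNoise (h : IsHierBandit p A P μ θ Y) : IndepFun μ (armNoise p μ θ) P :=
  (indepFun_iff_hasLaw_prodMk_prod h.law_effects h.hasLaw_armNoise_snd).2 h.hasLaw_armNoise

theorem indepFun_rewardNoise (h : IsHierBandit p A P μ θ Y) :
    IndepFun (fun x => (μ x, θ x)) (rewardNoise A θ Y) P :=
  (indepFun_iff_hasLaw_prodMk_prod
    ⟨(h.measurable_effects.prodMk h.measurable_means).aemeasurable, rfl⟩
    h.hasLaw_rewardNoise_snd).2 h.hasLaw_rewardNoise

theorem hasGaussianLaw_means (h : IsHierBandit p A P μ θ Y) : HasGaussianLaw θ P := by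
  have h1 := h.hasLaw_armNoise.hasGaussianLaw
  let F : EuclideanSpace ℝ (Fin L) × (Fin K → ℝ) →L[ℝ] (Fin K → ℝ) :=
    LinearMap.toContinuousLinearMap
      { toFun := fun q i => p.b i ⬝ᵥ q.1.ofLp + q.2 i
        map_add' := fun x y => by
          ext i; simp only [Prod.fst_add, WithLp.ofLp_add, dotProduct_add, Prod.snd_add, Pi.add_apply]
          ring
        map_smul' := fun c x => by ext i; simp [mul_add] }
  refine (h1.map F).congr (EventuallyEq.of_eq ?_)
  ext x i
  change p.b i ⬝ᵥ (μ x).ofLp + (θ x i - p.b i ⬝ᵥ (μ x).ofLp) = θ x i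
  ring

/-- The pair is a linear image of `θ` and the reward noise, which are Gaussian and independent. -/
theorem hasGaussianLaw_means_rewards (h : IsHierBandit p A P μ θ Y) :
    HasGaussianLaw (fun x => (θ x, Y x)) P := by
  have h1 := (h.indepFun_rewardNoise.comp measurable_snd measurable_id).hasGaussianLaw
    h.hasGaussianLaw_means h.hasLaw_rewardNoise_snd.hasGaussianLaw
  let F : (Fin K → ℝ) × (Fin T → ℝ) →L[ℝ] (Fin K → ℝ) × (Fin T → ℝ) :=
    LinearMap.toContinuousLinearMap
      { toFun := fun q => (q.1, fun t => q.1 (A t) + q.2 t)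
        map_add' := fun x y => by ext i <;> simp; ring
        map_smul' := fun c x => by ext i <;> simp [mul_add] }
  refine (h1.map F).congr (EventuallyEq.of_eq ?_)
  ext x i
  · rfl
  · change θ x (A i) + (Y x i - θ x (A i)) = Y x i
    ring

theorem memLp_mean (h : IsHierBandit p A P μ θ Y) (i : Fin K) :
    MemLp (fun x => θ x i) 2 P :=
  (h.hasGaussianLaw_means.eval i).memLp_two

theorem memLp_reward (h : IsHierBandit p A P μ θ Y) (t : Fin T) :
    MemLp (fun x => Y x t) 2 P :=
  (h.hasGaussianLaw_means_rewards.snd.eval t).memLp_two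

theorem integral_mean (h : IsHierBandit p A P μ θ Y) (i : Fin K) :
    ∫ x, θ x i ∂P = p.b i ⬝ᵥ p.ν := by
  have hη : HasLaw (fun x => armNoise p μ θ x i) (gaussianReal 0 (Real.toNNReal (p.σ₀ i ^ 2))) P :=
    (measurePreserving_eval (fun i => gaussianReal 0 (Real.toNNReal (p.σ₀ i ^ 2))) i).hasLaw.comp
      h.hasLaw_armNoise_snd
  have e : ∀ x, θ x i = p.b i ⬝ᵥ (μ x).ofLp + armNoise p μ θ x i := fun x => by
    change θ x i = p.b i ⬝ᵥ (μ x).ofLp + (θ x i - p.b i ⬝ᵥ (μ x).ofLp); ring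
  simp_rw [e]
  rw [integral_add ((h.memLp_effects _).integrable (by simp)) hη.hasGaussianLaw.integrable,
    hη.integral_eq, integral_id_gaussianReal, add_zero]
  have e2 : ∀ x, p.b i ⬝ᵥ (μ x).ofLp = innerSL ℝ (WithLp.toLp 2 (p.b i)) (μ x) := fun x => by
    simp [PiLp.inner_apply, dotProduct, mul_comm]
  simp_rw [e2]
  rw [ContinuousLinearMap.integral_comp_comm _ h.law_effects.hasGaussianLaw.integrable,
    h.law_effects.integral_eq, integral_id_multivariateGaussian]
  simp [PiLp.inner_apply, dotProduct, mul_comm]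

theorem covariance_means (h : IsHierBandit p A P μ θ Y) (hS : p.S.PosSemidef) (i j : Fin K) :
    cov[fun x => θ x i, fun x => θ x j; P] = p.armCov i j := by
  have e : ∀ i, (fun x => θ x i) =
      (fun x => p.b i ⬝ᵥ (μ x).ofLp) + fun x => armNoise p μ θ x i := fun i => by
    ext x
    change θ x i = p.b i ⬝ᵥ (μ x).ofLp + (θ x i - p.b i ⬝ᵥ (μ x).ofLp); ring
  have hη : ∀ i, MemLp (fun x => armNoise p μ θ x i) 2 P := fun i =>
    (h.hasLaw_armNoise_snd.hasGaussianLaw.eval i).memLp_two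
  have hb := h.memLp_effects
  have h0 : ∀ i j, cov[fun x => p.b i ⬝ᵥ (μ x).ofLp, fun x => armNoise p μ θ x j; P] = 0 :=
    fun i j => IndepFun.covariance_eq_zero
      (h.indepFun_armNoise.comp (φ := fun m : EuclideanSpace ℝ (Fin L) => p.b i ⬝ᵥ m.ofLp) (ψ := fun w : Fin K → ℝ => w j)
        (by unfold dotProduct; fun_prop) (measurable_pi_apply j)) (hb _) (hη j)
  have h1 : cov[fun x => armNoise p μ θ x i, fun x => armNoise p μ θ x j; P] =
      if i = j then p.σ₀ i ^ 2 else 0 := by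
    rw [h.hasLaw_armNoise_snd.covariance_fun_comp (f := fun w => w i) (g := fun w => w j)
      (measurable_pi_apply i).aemeasurable (measurable_pi_apply j).aemeasurable, covariance_eval_pi_gaussianReal]
    simp [sq_nonneg]
  rw [e i, e j, covariance_add_left (hb _) (hη _) ((hb _).add (hη _)),
    covariance_add_right (hb _) (hb _) (hη _), covariance_add_right (hη _) (hb _) (hη _),
    h0, covariance_comm (fun x => armNoise p μ θ x i), h0, h1, h.covariance_effects hS]
  simp [HierParams.armCov]

theorem covariance_mean_rewardNoise (h : IsHierBandit p A P μ θ Y) (i : Fin K) (t : Fin T) :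
    cov[fun x => θ x i, fun x => rewardNoise A θ Y x t; P] = 0 :=
  IndepFun.covariance_eq_zero
    (h.indepFun_rewardNoise.comp (φ := fun q : EuclideanSpace ℝ (Fin L) × (Fin K → ℝ) => q.2 i) (ψ := fun w : Fin T → ℝ => w t)
      (by fun_prop) (measurable_pi_apply t)) (h.memLp_mean i)
    (h.hasLaw_rewardNoise_snd.hasGaussianLaw.eval t).memLp_two

theorem covariance_mean_reward (h : IsHierBandit p A P μ θ Y) (hS : p.S.PosSemidef) (i : Fin K)
    (t : Fin T) : cov[fun x => θ x i, fun x => Y x t; P] = p.armCov i (A t) := by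
  rw [reward_eq A θ Y, covariance_add_right (h.memLp_mean i) (h.memLp_mean _)
    (h.hasLaw_rewardNoise_snd.hasGaussianLaw.eval t).memLp_two, h.covariance_means hS,
    h.covariance_mean_rewardNoise, add_zero]

theorem covariance_rewards (h : IsHierBandit p A P μ θ Y) (hS : p.S.PosSemidef) (s t : Fin T) :
    cov[fun x => Y x s, fun x => Y x t; P] =
      p.armCov (A s) (A t) + if s = t then p.σ ^ 2 else 0 := by
  have hε := fun t => (h.hasLaw_rewardNoise_snd.hasGaussianLaw.eval t).memLp_two
  have h1 : cov[fun x => rewardNoise A θ Y x s, fun x => rewardNoise A θ Y x t; P] =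
      if s = t then p.σ ^ 2 else 0 := by
    rw [h.hasLaw_rewardNoise_snd.covariance_fun_comp (f := fun w => w s) (g := fun w => w t)
      (measurable_pi_apply s).aemeasurable (measurable_pi_apply t).aemeasurable, covariance_eval_pi_gaussianReal]
    simp [sq_nonneg]
  rw [reward_eq A θ Y s, covariance_add_left (h.memLp_mean _) (hε s) (h.memLp_reward t),
    h.covariance_mean_reward hS, reward_eq A θ Y t,
    covariance_add_right (hε s) (h.memLp_mean _) (hε t), covariance_comm,
    h.covariance_mean_rewardNoise, zero_add, h1]

end IsHierBandit

/-! ### The linear predictor, its error, and the posterior mean. -/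

theorem sum_comp_eq_sum_card_mul {α β : Type*} [Fintype α] [Fintype β] [DecidableEq β]
    (A : α → β) (m : β → ℕ) (hA : ∀ b, (Finset.univ.filter fun a => A a = b).card = m b)
    (f : β → ℝ) : ∑ a, f (A a) = ∑ b, m b * f b := by
  rw [← Finset.sum_fiberwise Finset.univ A]
  refine Finset.sum_congr rfl fun b _ => ?_
  rw [← hA b, ← nsmul_eq_mul, ← Finset.sum_const]
  exact Finset.sum_congr rfl fun a ha => by rw [(Finset.mem_filter.1 ha).2]

/-- The best linear predictor of `θ i` from the rewards, up to an additive constant. -/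
def linPred {K L T : ℕ} (p : HierParams K L) (m : Fin K → ℕ) (A : Fin T → Fin K) {Ω : Type u}
    (Y : Ω → Fin T → ℝ) (i : Fin K) : Ω → ℝ :=
  fun x => ∑ t, p.gain m i (A t) * Y x t

/-- The error of the best linear predictor of `θ i`. -/
def predErr {K L T : ℕ} (p : HierParams K L) (m : Fin K → ℕ) (A : Fin T → Fin K) {Ω : Type u}
    (θ : Ω → Fin K → ℝ) (Y : Ω → Fin T → ℝ) (i : Fin K) : Ω → ℝ :=
  fun x => θ x i - linPred p m A Y i x

namespace IsHierBandit

variable {K L T : ℕ} {p : HierParams K L} {A : Fin T → Fin K} {Ω : Type u} [MeasurableSpace Ω]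
  {P : Measure Ω} {μ : Ω → EuclideanSpace ℝ (Fin L)} {θ : Ω → Fin K → ℝ} {Y : Ω → Fin T → ℝ}
  [IsProbabilityMeasure P] {m : Fin K → ℕ}

theorem memLp_linPred (h : IsHierBandit p A P μ θ Y) (i : Fin K) :
    MemLp (linPred p m A Y i) 2 P :=
  memLp_finsetSum _ fun t _ => (h.memLp_reward t).const_mul _

theorem memLp_predErr (h : IsHierBandit p A P μ θ Y) (i : Fin K) :
    MemLp (predErr p m A θ Y i) 2 P :=
  (h.memLp_mean i).sub (h.memLp_linPred i)

/-- Grouping the rounds by arm turns this into `gain_normal_eq`; the term with `σ²` comes from the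
noise of round `t` itself. -/
theorem covariance_linPred_reward (h : IsHierBandit p A P μ θ Y) (hS : p.S.PosDef) (hσ : 0 < p.σ)
    (hA : ∀ k, (Finset.univ.filter fun t => A t = k).card = m k) (i : Fin K) (t : Fin T) :
    cov[linPred p m A Y i, fun x => Y x t; P] = p.armCov i (A t) := by
  unfold linPred
  rw [covariance_fun_sum_left (fun t => (h.memLp_reward t).const_mul _) (h.memLp_reward t)]
  simp_rw [covariance_const_mul_left, h.covariance_rewards hS.posSemidef, mul_add,
    Finset.sum_add_distrib]
  rw [sum_comp_eq_sum_card_mul A m hA (fun l => p.gain m i l * p.armCov l (A t)),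
    ← p.gain_normal_eq m hS hσ i (A t)]
  congr 1
  · exact Finset.sum_congr rfl fun l _ => by ring
  · simp [mul_comm]

theorem covariance_linPred_mean (h : IsHierBandit p A P μ θ Y) (hS : p.S.PosDef) (hσ : 0 < p.σ)
    (hA : ∀ k, (Finset.univ.filter fun t => A t = k).card = m k) (i j : Fin K) :
    cov[linPred p m A Y i, fun x => θ x j; P] = p.armCov i j - p.σ ^ 2 * p.gain m i j := by
  unfold linPred
  rw [covariance_fun_sum_left (fun t => (h.memLp_reward t).const_mul _) (h.memLp_mean j)]
  simp_rw [covariance_const_mul_left, covariance_comm _ (fun x => θ x j),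
    h.covariance_mean_reward hS.posSemidef]
  rw [sum_comp_eq_sum_card_mul A m hA (fun l => p.gain m i l * p.armCov j l),
    ← p.gain_normal_eq m hS hσ i j, add_sub_cancel_right]
  exact Finset.sum_congr rfl fun l _ => by rw [p.armCov_symm hS j l]; ring

theorem covariance_predErr_reward (h : IsHierBandit p A P μ θ Y) (hS : p.S.PosDef) (hσ : 0 < p.σ)
    (hA : ∀ k, (Finset.univ.filter fun t => A t = k).card = m k) (i : Fin K) (t : Fin T) :
    cov[predErr p m A θ Y i, fun x => Y x t; P] = 0 := by
  unfold predErr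
  rw [covariance_fun_sub_left (h.memLp_mean i) (h.memLp_linPred i) (h.memLp_reward t),
    h.covariance_mean_reward hS.posSemidef, h.covariance_linPred_reward hS hσ hA, sub_self]

theorem covariance_predErr_linPred (h : IsHierBandit p A P μ θ Y) (hS : p.S.PosDef) (hσ : 0 < p.σ)
    (hA : ∀ k, (Finset.univ.filter fun t => A t = k).card = m k) (i j : Fin K) :
    cov[predErr p m A θ Y i, linPred p m A Y j; P] = 0 := by
  unfold linPred
  rw [covariance_fun_sum_right (fun t => (h.memLp_reward t).const_mul _) (h.memLp_predErr i)]
  simp_rw [covariance_const_mul_right, h.covariance_predErr_reward hS hσ hA, mul_zero,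
    Finset.sum_const_zero]

theorem covariance_predErr (h : IsHierBandit p A P μ θ Y) (hS : p.S.PosDef) (hσ : 0 < p.σ)
    (hA : ∀ k, (Finset.univ.filter fun t => A t = k).card = m k) (i j : Fin K) :
    cov[predErr p m A θ Y i, predErr p m A θ Y j; P] = p.σ ^ 2 * p.gain m i j := by
  have : predErr p m A θ Y j = fun x => θ x j - linPred p m A Y j x := rfl
  rw [this, covariance_fun_sub_right (h.memLp_predErr i) (h.memLp_mean j) (h.memLp_linPred j),
    h.covariance_predErr_linPred hS hσ hA]
  unfold predErr
  rw [covariance_fun_sub_left (h.memLp_mean i) (h.memLp_linPred i) (h.memLp_mean j),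
    h.covariance_means hS.posSemidef, h.covariance_linPred_mean hS hσ hA]
  ring

theorem covariance_linPred (h : IsHierBandit p A P μ θ Y) (hS : p.S.PosDef) (hσ : 0 < p.σ)
    (hA : ∀ k, (Finset.univ.filter fun t => A t = k).card = m k) (i j : Fin K) :
    cov[linPred p m A Y i, linPred p m A Y j; P] = p.armCov i j - p.σ ^ 2 * p.gain m i j := by
  have : linPred p m A Y j = fun x => θ x j - predErr p m A θ Y j x := by
    ext x; simp [predErr]
  rw [this, covariance_fun_sub_right (h.memLp_linPred i) (h.memLp_mean j) (h.memLp_predErr j),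
    covariance_comm _ (predErr p m A θ Y j), h.covariance_predErr_linPred hS hσ hA,
    h.covariance_linPred_mean hS hσ hA, sub_zero]

theorem variance_sub_predErr (h : IsHierBandit p A P μ θ Y) (hS : p.S.PosDef) (hσ : 0 < p.σ)
    (hA : ∀ k, (Finset.univ.filter fun t => A t = k).card = m k) (i j : Fin K) :
    Var[fun x => predErr p m A θ Y i x - predErr p m A θ Y j x; P] = p.postVar m i j := by
  have hi := h.memLp_predErr (m := m) i
  have hj := h.memLp_predErr (m := m) j
  have hm : AEMeasurable (fun x => predErr p m A θ Y i x - predErr p m A θ Y j x) P :=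
    (hi.sub hj).aemeasurable
  rw [← covariance_self hm, covariance_fun_sub_fun_sub hi hj hi hj]
  simp_rw [h.covariance_predErr hS hσ hA]
  unfold HierParams.postVar
  ring

theorem variance_sub_linPred (h : IsHierBandit p A P μ θ Y) (hS : p.S.PosDef) (hσ : 0 < p.σ)
    (hA : ∀ k, (Finset.univ.filter fun t => A t = k).card = m k) (i j : Fin K) :
    Var[fun x => linPred p m A Y i x - linPred p m A Y j x; P] = p.c m i j := by
  have hi := h.memLp_linPred (m := m) i
  have hj := h.memLp_linPred (m := m) j
  have hm : AEMeasurable (fun x => linPred p m A Y i x - linPred p m A Y j x) P :=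
    (hi.sub hj).aemeasurable
  rw [← covariance_self hm, covariance_fun_sub_fun_sub hi hj hi hj]
  simp_rw [h.covariance_linPred hS hσ hA]
  rw [p.c_eq m hS hσ]
  unfold HierParams.postVar
  ring

theorem hasGaussianLaw_predErr (h : IsHierBandit p A P μ θ Y) :
    HasGaussianLaw (fun x => ((fun i => predErr p m A θ Y i x), Y x)) P := by
  let F : (Fin K → ℝ) × (Fin T → ℝ) →L[ℝ] (Fin K → ℝ) × (Fin T → ℝ) :=
    LinearMap.toContinuousLinearMap
      { toFun := fun q => (fun i => q.1 i - ∑ t, p.gain m i (A t) * q.2 t, q.2)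
        map_add' := fun x y => by
          ext i
          · simp [mul_add, Finset.sum_add_distrib]; ring
          · simp
        map_smul' := fun c x => by
          ext i
          · simp [mul_sub, Finset.mul_sum, mul_left_comm]
          · simp }
  exact h.hasGaussianLaw_means_rewards.map F

/-- For jointly Gaussian vectors, vanishing cross-covariances imply independence. -/
theorem indepFun_predErr (h : IsHierBandit p A P μ θ Y) (hS : p.S.PosDef) (hσ : 0 < p.σ)
    (hA : ∀ k, (Finset.univ.filter fun t => A t = k).card = m k) :
    IndepFun (fun x i => predErr p m A θ Y i x) Y P :=
  HasGaussianLaw.indepFun_of_covariance_eval (Y := fun t x => Y x t) h.hasGaussianLaw_predErr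
    (h.covariance_predErr_reward hS hσ hA)

/-- In `θ i = linPred + predErr`, the first term is a function of the rewards and the second is
independent of them, so conditioning keeps the one and averages the other. -/
theorem posteriorMean_ae_eq (h : IsHierBandit p A P μ θ Y) (hS : p.S.PosDef) (hσ : 0 < p.σ)
    (hA : ∀ k, (Finset.univ.filter fun t => A t = k).card = m k) (i : Fin K) :
    posteriorMean P θ Y i =ᵐ[P] fun x => linPred p m A Y i x + ∫ y, predErr p m A θ Y i y ∂P := by
  have hle : MeasurableSpace.comap Y inferInstance ≤ (inferInstance : MeasurableSpace Ω) :=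
    h.measurable_rewards.comap_le
  have hl := (h.memLp_linPred (m := m) i).integrable (by simp)
  have he := (h.memLp_predErr (m := m) i).integrable (by simp)
  have e : (fun x => θ x i) = linPred p m A Y i + predErr p m A θ Y i := by
    ext x; simp [predErr]
  have hlm : StronglyMeasurable[MeasurableSpace.comap Y inferInstance] (linPred p m A Y i) :=
    (Measurable.comp (g := fun y : Fin T → ℝ => ∑ t, p.gain m i (A t) * y t) (by fun_prop)
      (comap_measurable Y)).stronglyMeasurable
  have hem : Measurable (predErr p m A θ Y i) :=
    ((measurable_pi_apply i).comp h.measurable_means).sub (hlm.measurable.mono hle le_rfl)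
  have hind : Indep (MeasurableSpace.comap (predErr p m A θ Y i) inferInstance)
      (MeasurableSpace.comap Y inferInstance) P :=
    (h.indepFun_predErr hS hσ hA).comp (φ := fun w : Fin K → ℝ => w i)
      (measurable_pi_apply i) measurable_id
  have h1 := condExp_indep_eq hem.comap_le hle
    (comap_measurable (predErr p m A θ Y i)).stronglyMeasurable hind
  unfold posteriorMean
  rw [e]
  refine (condExp_add hl he _).trans ?_
  rw [condExp_of_stronglyMeasurable hle hlm hl]
  filter_upwards [h1] with x hx
  rw [Pi.add_apply, hx]

theorem variance_sub_posteriorMean (h : IsHierBandit p A P μ θ Y) (hS : p.S.PosDef) (hσ : 0 < p.σ)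
    (hA : ∀ k, (Finset.univ.filter fun t => A t = k).card = m k) (i j : Fin K) :
    Var[fun x => posteriorMean P θ Y i x - posteriorMean P θ Y j x; P] = p.c m i j := by
  have hi := h.memLp_linPred (m := m) i
  have hj := h.memLp_linPred (m := m) j
  have hm : AEStronglyMeasurable (fun x => linPred p m A Y i x - linPred p m A Y j x) P :=
    (hi.sub hj).aestronglyMeasurable
  rw [← h.variance_sub_linPred hS hσ hA i j, ← variance_add_const hm
    (∫ y, predErr p m A θ Y i y ∂P - ∫ y, predErr p m A θ Y j y ∂P)]
  refine variance_congr ?_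
  filter_upwards [h.posteriorMean_ae_eq hS hσ hA i, h.posteriorMean_ae_eq hS hσ hA j] with x h1 h2
  rw [h1, h2]
  ring

/-! ### From the law of error and gap to the bound on the probability of error. -/

/-- The joint law of the centered error and of the difference of the posterior means of two arms. -/
theorem hasLaw_error_gap (h : IsHierBandit p A P μ θ Y) (hS : p.S.PosDef) (hσ : 0 < p.σ)
    (hA : ∀ k, (Finset.univ.filter fun t => A t = k).card = m k) (i j : Fin K) :
    HasLaw (fun x =>
        (predErr p m A θ Y i x - predErr p m A θ Y j x
          - (∫ y, predErr p m A θ Y i y ∂P - ∫ y, predErr p m A θ Y j y ∂P),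
        linPred p m A Y i x - linPred p m A Y j x
          + (∫ y, predErr p m A θ Y i y ∂P - ∫ y, predErr p m A θ Y j y ∂P)))
      ((gaussianReal 0 (Real.toNNReal (p.postVar m i j))).prod
        (gaussianReal (p.ν ⬝ᵥ p.b i - p.ν ⬝ᵥ p.b j) (Real.toNNReal (p.c m i j)))) P := by
  have hl := fun i => (h.memLp_linPred (m := m) i).integrable (by simp)
  have he := fun i => (h.memLp_predErr (m := m) i).integrable (by simp)
  set a := ∫ y, predErr p m A θ Y i y ∂P - ∫ y, predErr p m A θ Y j y ∂P with ha
  have hG := h.hasGaussianLaw_predErr (m := m)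
  have gR : HasGaussianLaw (fun x => predErr p m A θ Y i x - predErr p m A θ Y j x) P :=
    (hG.fst.map (ContinuousLinearMap.proj (R := ℝ) (φ := fun _ : Fin K => ℝ) i
      - ContinuousLinearMap.proj j)).congr (EventuallyEq.of_eq (by ext x; simp))
  have gD : HasGaussianLaw (fun x => linPred p m A Y i x - linPred p m A Y j x) P := by
    refine (hG.snd.map (∑ t, (p.gain m i (A t) - p.gain m j (A t)) •
      ContinuousLinearMap.proj (R := ℝ) (φ := fun _ : Fin T => ℝ) t)).congr
      (EventuallyEq.of_eq ?_)
    ext x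
    simp [linPred, sub_mul]
  have lR := gR.map_eq_gaussianReal
  have lD := gD.map_eq_gaussianReal
  rw [h.variance_sub_predErr hS hσ hA, integral_sub (he i) (he j), ← ha] at lR
  rw [h.variance_sub_linPred hS hσ hA] at lD
  have lR' := gaussianReal_sub_const ⟨gR.aemeasurable, lR⟩ a
  have lD' := gaussianReal_add_const ⟨gD.aemeasurable, lD⟩ a
  have hmean : ∫ x, (linPred p m A Y i x - linPred p m A Y j x) ∂P + a =
      p.ν ⬝ᵥ p.b i - p.ν ⬝ᵥ p.b j := by
    rw [ha, integral_sub (hl i) (hl j), dotProduct_comm p.ν, dotProduct_comm p.ν,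
      ← h.integral_mean i, ← h.integral_mean j]
    have e : ∀ i, ∫ x, θ x i ∂P = ∫ x, linPred p m A Y i x ∂P + ∫ x, predErr p m A θ Y i x ∂P :=
      fun i => by
        rw [← integral_add (hl i) (he i)]
        exact integral_congr_ae (ae_of_all _ fun x => by simp [predErr])
    rw [e i, e j]
    ring
  rw [sub_self] at lR'
  rw [hmean] at lD'
  refine (indepFun_iff_hasLaw_prodMk_prod lR' lD').1 ?_
  exact (h.indepFun_predErr hS hσ hA).comp
    (φ := fun w : Fin K → ℝ => w i - w j - a)
    (ψ := fun y : Fin T → ℝ => ∑ t, p.gain m i (A t) * y t - ∑ t, p.gain m j (A t) * y t + a)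
    (by fun_prop) (by fun_prop)

theorem c_nonneg (h : IsHierBandit p A P μ θ Y) (hS : p.S.PosDef) (hσ : 0 < p.σ)
    (hA : ∀ k, (Finset.univ.filter fun t => A t = k).card = m k) (i j : Fin K) :
    0 ≤ p.c m i j := by
  rw [← h.variance_sub_linPred hS hσ hA]
  exact variance_nonneg _ _

/-- The probability of returning arm `i` although arm `j` is at least as good. -/
theorem measureReal_wrong_le (h : IsHierBandit p A P μ θ Y) (hS : p.S.PosDef)
    (hσ₀ : ∀ i, 0 < p.σ₀ i) (hσ : 0 < p.σ)
    (hA : ∀ k, (Finset.univ.filter fun t => A t = k).card = m k) {J : Ω → Fin K}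
    (hJ : IsDecision P θ Y J) {i j : Fin K} (hij : i ≠ j) :
    P.real {x | J x = i ∧ θ x i ≤ θ x j} ≤
      1 / Real.sqrt (1 + p.c m i j / (p.margVar m i + p.margVar m j)) *
        Real.exp (-(p.ν ⬝ᵥ p.b i - p.ν ⬝ᵥ p.b j) ^ 2 / (2 * p.gapVar i j)) := by
  have hv := p.postVar_pos m hS hσ₀ hσ hij
  have hc := h.c_nonneg hS hσ hA i j
  have hM := add_pos (p.margVar_pos m hS hσ₀ hσ i) (p.margVar_pos m hS hσ₀ hσ j)
  have hL := h.hasLaw_error_gap hS hσ hA i j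
  have hm : MeasurableSet {q : ℝ × ℝ | 0 ≤ q.2 ∧ q.1 + q.2 ≤ 0} :=
    (measurableSet_le measurable_const measurable_snd).inter
      (measurableSet_le (measurable_fst.add measurable_snd) measurable_const)
  have h1 : P {x | J x = i ∧ θ x i ≤ θ x j} ≤
      ((gaussianReal 0 (Real.toNNReal (p.postVar m i j))).prod
        (gaussianReal (p.ν ⬝ᵥ p.b i - p.ν ⬝ᵥ p.b j) (Real.toNNReal (p.c m i j))))
        {q | 0 ≤ q.2 ∧ q.1 + q.2 ≤ 0} := by
    rw [← hL.measure_eq hm]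
    refine measure_mono_ae ?_
    -- The argmax property makes the gap nonnegative; error plus gap equals `θ i - θ j`, which is
    -- nonpositive on the event.
    filter_upwards [hJ.argmax, h.posteriorMean_ae_eq hS hσ hA i,
      h.posteriorMean_ae_eq hS hσ hA j] with x hx hi hj hx'
    obtain ⟨rfl, hle⟩ := hx'
    have := hx j
    rw [hi, hj] at this
    refine ⟨by linarith, ?_⟩
    simp only [predErr]
    linarith
  have h2 := h1.trans (prod_gaussianReal_sign_error_le _ (by simpa using hv) _)
  rw [Real.coe_toNNReal _ hv.le, Real.coe_toNNReal _ hc, add_comm _ (p.c m i j),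
    p.c_add_postVar m hS hσ hij, ← mul_assoc] at h2
  refine (ENNReal.toReal_le_of_le_ofReal (by positivity) h2).trans ?_
  gcongr
  rw [← p.c_add_postVar m hS hσ hij, add_comm (p.c m i j)]
  exact half_sqrt_le_inv_sqrt hv hc hM (p.postVar_le m hS hσ₀ hσ hij)

/-- The tower property removes the conditioning on `θ`. -/
theorem expectedPoE_eq (h : IsHierBandit p A P μ θ Y) {J : Ω → Fin K}
    (hJ : IsDecision P θ Y J) :
    expectedPoE P θ J = P.real {y | ¬ IsOptimalArm (θ y) (J y)} := by
  unfold expectedPoE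
  rw [integral_condExp h.measurable_means.comap_le]
  refine integral_indicator_one ?_
  have hJm : Measurable J := hJ.measurable.mono h.measurable_rewards.comap_le le_rfl
  have hθ : ∀ i, Measurable fun x => θ x i := fun i =>
    (measurable_pi_apply i).comp h.measurable_means
  have : {y | ¬ IsOptimalArm (θ y) (J y)} =
      ⋃ k, ⋃ i, ⋃ _ : i ≠ k, {y | J y = k} ∩ {y | θ y k ≤ θ y i} := by
    ext y
    simp [IsOptimalArm]
  rw [this]
  exact .iUnion fun k => .iUnion fun i => .iUnion fun _ =>
    (hJm (measurableSet_singleton k)).inter (measurableSet_le (hθ k) (hθ i))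

theorem expectedPoE_le (h : IsHierBandit p A P μ θ Y) (hS : p.S.PosDef)
    (hσ₀ : ∀ i, 0 < p.σ₀ i) (hσ : 0 < p.σ)
    (hA : ∀ k, (Finset.univ.filter fun t => A t = k).card = m k) {J : Ω → Fin K}
    (hJ : IsDecision P θ Y J) : expectedPoE P θ J ≤ p.poeBound m := by
  rw [h.expectedPoE_eq hJ]
  -- An error means that some other arm is at least as good as the returned one; ties count as
  -- errors, hence the weak inequality.
  have hsub : {y | ¬ IsOptimalArm (θ y) (J y)} ⊆ ⋃ i ∈ (Finset.univ : Finset (Fin K)),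
      ⋃ j ∈ Finset.univ.filter (fun j => j ≠ i), {x | J x = i ∧ θ x i ≤ θ x j} := by
    intro y hy
    simpa [IsOptimalArm] using hy
  refine (measureReal_mono hsub (measure_ne_top _ _)).trans ((measureReal_biUnion_finset_le _ _).trans ?_)
  refine Finset.sum_le_sum fun i _ => (measureReal_biUnion_finset_le _ _).trans ?_
  refine Finset.sum_le_sum fun j hj => ?_
  exact h.measureReal_wrong_le hS hσ₀ hσ hA hJ (Finset.mem_filter.1 hj).2.symm

end IsHierBandit

/-! ### Asymptotics in the budget. -/

namespace HierParams

variable {K L : ℕ} {p : HierParams K L}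

theorem exists_margVar_le (hS : p.S.PosDef) (hσ₀ : ∀ i, 0 < p.σ₀ i) (hσ : 0 < p.σ)
    {ω : Fin K → ℝ} (hω : ∀ i, 0 < ω i) (i : Fin K) :
    ∃ C, 0 < C ∧ ∀ n : ℕ, 1 ≤ n → p.margVar (pulls ω n) i ≤ C / n := by
  have h0 := hσ₀ i
  have hi := hω i
  have hb : 0 ≤ p.b i ⬝ᵥ (p.S *ᵥ p.b i) := by
    simpa using hS.posSemidef.dotProduct_mulVec_nonneg (p.b i)
  -- With this minimum `s`, `d ≥ s * (pulls + 1) ≥ s * ω i * n`: the `σ²` in `d` makes up for the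
  -- pull lost to the floor.
  have hmin : 0 < min (p.σ₀ i ^ 2) (p.σ ^ 2) := by positivity
  refine ⟨p.σ ^ 2 / (min (p.σ₀ i ^ 2) (p.σ ^ 2) * ω i) *
    (p.σ₀ i ^ 2 + p.b i ⬝ᵥ (p.S *ᵥ p.b i)), by positivity, fun n hn => ?_⟩
  have hn' : (0 : ℝ) < n := by exact_mod_cast hn
  refine (p.margVar_le _ hS hσ₀ hσ i).trans ?_
  rw [mul_div_right_comm, div_div]
  gcongr
  have h1 : ω i * n ≤ pulls ω n i + 1 := (Nat.lt_floor_add_one _).le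
  calc min (p.σ₀ i ^ 2) (p.σ ^ 2) * ω i * n
      ≤ min (p.σ₀ i ^ 2) (p.σ ^ 2) * (pulls ω n i + 1) := by
        rw [mul_assoc]; gcongr
    _ = pulls ω n i * min (p.σ₀ i ^ 2) (p.σ ^ 2) + min (p.σ₀ i ^ 2) (p.σ ^ 2) := by ring
    _ ≤ p.d (pulls ω n) i := by
        unfold d
        gcongr
        · exact min_le_left _ _
        · exact min_le_right _ _

theorem eventually_le_c (hS : p.S.PosDef) (hσ₀ : ∀ i, 0 < p.σ₀ i) (hσ : 0 < p.σ)
    {ω : Fin K → ℝ} (hω : ∀ i, 0 < ω i) {i j : Fin K} (hij : i ≠ j) :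
    ∃ κ : ℝ, 0 < κ ∧ ∀ᶠ n : ℕ in atTop, κ ≤ p.c (pulls ω n) i j := by
  have h1 := hσ₀ i
  have h2 := hσ₀ j
  obtain ⟨Ci, _, hi⟩ := exists_margVar_le hS hσ₀ hσ hω i
  obtain ⟨Cj, _, hj⟩ := exists_margVar_le hS hσ₀ hσ hω j
  have hgap : 0 < p.gapVar i j := by
    have : 0 ≤ (p.b i - p.b j) ⬝ᵥ (p.S *ᵥ (p.b i - p.b j)) := by
      simpa using hS.posSemidef.dotProduct_mulVec_nonneg (p.b i - p.b j)
    unfold gapVar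
    positivity
  -- Here `c = gapVar - postVar` and `postVar` is `O(1/n)`, so any constant below `gapVar` would
  -- serve.
  refine ⟨p.gapVar i j / 2, by positivity, ?_⟩
  have ht : Tendsto (fun n : ℕ => 2 * (Ci / n + Cj / n)) atTop (nhds (2 * (0 + 0))) :=
    ((tendsto_const_div_atTop_nhds_zero_nat Ci).add
      (tendsto_const_div_atTop_nhds_zero_nat Cj)).const_mul 2
  have hlt : 2 * ((0 : ℝ) + 0) < p.gapVar i j / 2 := by simpa using hgap
  filter_upwards [ht.eventually_lt_const hlt, eventually_ge_atTop 1] with n hn hn1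
  have h3 := p.postVar_le (pulls ω n) hS hσ₀ hσ hij
  have h4 := p.c_add_postVar (pulls ω n) hS hσ hij
  have h5 := hi n hn1
  have h6 := hj n hn1
  linarith

theorem eventually_div_le_margVar (hS : p.S.PosDef) (hσ₀ : ∀ i, 0 < p.σ₀ i) (hσ : 0 < p.σ)
    {ω : Fin K → ℝ} (hω : ∀ i, 0 < ω i) (i : Fin K) :
    ∃ κ : ℝ, 0 < κ ∧ ∀ᶠ n : ℕ in atTop, κ / (n : ℝ) ≤ p.margVar (pulls ω n) i := by
  have h0 := hσ₀ i
  have hi := hω i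
  -- For `n ≥ 1` the precision `1/σ₀² + pulls/σ²` is at most `n` times `1/σ₀² + ω i/σ²`.
  refine ⟨(1 / p.σ₀ i ^ 2 + ω i / p.σ ^ 2)⁻¹, by positivity, ?_⟩
  filter_upwards [eventually_ge_atTop 1] with n hn
  have hn' : (1 : ℝ) ≤ n := by exact_mod_cast hn
  refine le_trans ?_ (p.condVar_le_margVar _ hS hσ i)
  unfold condVar
  rw [div_eq_mul_inv, ← mul_inv]
  gcongr
  have h1 : (pulls ω n i : ℝ) ≤ ω i * n := Nat.floor_le (by positivity)
  rw [add_mul]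
  refine add_le_add (le_mul_of_one_le_right (by positivity) hn') ?_
  rw [div_mul_eq_mul_div]
  gcongr

theorem exists_poeBound_le (hS : p.S.PosDef) (hσ₀ : ∀ i, 0 < p.σ₀ i) (hσ : 0 < p.σ)
    {ω : Fin K → ℝ} (hω : ∀ i, 0 < ω i) :
    ∃ C : ℝ, ∀ n : ℕ, 1 ≤ n → p.poeBound (pulls ω n) ≤ C / Real.sqrt n := by
  choose D hD hmarg using exists_margVar_le hS hσ₀ hσ hω
  have key : ∀ i, ∀ j ∈ Finset.univ.filter (fun j => j ≠ i), ∃ B : ℝ, ∀ᶠ n : ℕ in atTop,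
      1 / Real.sqrt (1 + p.c (pulls ω n) i j / (p.margVar (pulls ω n) i + p.margVar (pulls ω n) j)) *
        Real.exp (-(p.ν ⬝ᵥ p.b i - p.ν ⬝ᵥ p.b j) ^ 2 / (2 * p.gapVar i j)) * Real.sqrt n ≤ B := by
    intro i j hj
    obtain ⟨κ, hκ, hc⟩ := eventually_le_c hS hσ₀ hσ hω (Finset.mem_filter.1 hj).2.symm
    refine ⟨Real.sqrt ((D i + D j) / κ) *
      Real.exp (-(p.ν ⬝ᵥ p.b i - p.ν ⬝ᵥ p.b j) ^ 2 / (2 * p.gapVar i j)), ?_⟩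
    filter_upwards [hc, eventually_ge_atTop 1] with n hn hn1
    have hn' : (0 : ℝ) < n := by exact_mod_cast hn1
    have hM := add_pos (p.margVar_pos (pulls ω n) hS hσ₀ hσ i)
      (p.margVar_pos (pulls ω n) hS hσ₀ hσ j)
    have hDD : 0 < D i + D j := add_pos (hD i) (hD j)
    rw [mul_right_comm]
    gcongr
    refine (mul_le_mul_of_nonneg_right
      (one_div_sqrt_one_add_div_le (hκ.trans_le hn) hM) (Real.sqrt_nonneg _)).trans ?_
    rw [← Real.sqrt_mul (div_nonneg hM.le (hκ.le.trans hn))]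
    refine Real.sqrt_le_sqrt ?_
    have h1 : p.margVar (pulls ω n) i + p.margVar (pulls ω n) j ≤ (D i + D j) / n := by
      rw [add_div]; exact add_le_add (hmarg i n hn1) (hmarg j n hn1)
    calc _ ≤ (D i + D j) / n / κ * n := by gcongr
      _ = (D i + D j) / κ := by field_simp
  choose! B hB using key
  have hbd : ∀ᶠ n : ℕ in atTop, p.poeBound (pulls ω n) * Real.sqrt n ≤
      ∑ i, ∑ j ∈ Finset.univ.filter (fun j => j ≠ i), B i j := by
    have : ∀ᶠ n : ℕ in atTop, ∀ i, ∀ j ∈ Finset.univ.filter (fun j => j ≠ i),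
        1 / Real.sqrt (1 + p.c (pulls ω n) i j /
          (p.margVar (pulls ω n) i + p.margVar (pulls ω n) j)) *
        Real.exp (-(p.ν ⬝ᵥ p.b i - p.ν ⬝ᵥ p.b j) ^ 2 / (2 * p.gapVar i j)) * Real.sqrt n
          ≤ B i j := by
      refine eventually_all.2 fun i => ?_
      rw [Finset.eventually_all]
      exact hB i
    filter_upwards [this] with n hn
    unfold poeBound
    simp_rw [Finset.sum_mul]
    exact Finset.sum_le_sum fun i _ => Finset.sum_le_sum fun j hj => hn i j hj
  -- A real sequence that is eventually bounded above is bounded above, which absorbs the small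
  -- budgets into the constant.
  obtain ⟨C, hC⟩ := (isBoundedUnder_of_eventually_le hbd).bddAbove_range
  refine ⟨C, fun n hn => ?_⟩
  have hn' : (0 : ℝ) < n := by exact_mod_cast hn
  rw [le_div_iff₀ (by positivity)]
  exact hC ⟨n, rfl⟩

end HierParams

end

theorem theorem3 {K L : ℕ} (p : HierParams K L)
    (hS : p.S.PosDef) (hσ₀ : ∀ i, 0 < p.σ₀ i) (hσ : 0 < p.σ)
    (ω : Fin K → ℝ) (hω_pos : ∀ i, 0 < ω i) (hω_sum : ∑ i, ω i = 1) :
    -- the bound, for every budget, and the meaning of `c`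
    (∀ (n T : ℕ) (A : Fin T → Fin K), IsSchedule ω n A →
      ∀ (Ω : Type u) [MeasurableSpace Ω] (P : Measure Ω) [IsProbabilityMeasure P]
        (μ : Ω → EuclideanSpace ℝ (Fin L)) (θ : Ω → Fin K → ℝ) (Y : Ω → Fin T → ℝ),
        IsHierBandit p A P μ θ Y →
        (∀ i j, ProbabilityTheory.variance
            (fun x => posteriorMean P θ Y i x - posteriorMean P θ Y j x) P
              = p.c (pulls ω n) i j) ∧
        ∀ J : Ω → Fin K, IsDecision P θ Y J →
          expectedPoE P θ J ≤ p.poeBound (pulls ω n)) ∧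
    -- `c i j = Ω(1)`
    (∀ i j, i ≠ j → ∃ κ : ℝ, 0 < κ ∧ ∀ᶠ n : ℕ in atTop, κ ≤ p.c (pulls ω n) i j) ∧
    -- the marginal posterior variances are `Ω(1/n)`
    (∀ i, ∃ κ : ℝ, 0 < κ ∧ ∀ᶠ n : ℕ in atTop, κ / (n : ℝ) ≤ p.margVar (pulls ω n) i) ∧
    -- the expected probability of error is `O(1/√n)`
    ∃ C : ℝ, ∀ (n T : ℕ) (A : Fin T → Fin K), 1 ≤ n → IsSchedule ω n A →
      ∀ (Ω : Type u) [MeasurableSpace Ω] (P : Measure Ω) [IsProbabilityMeasure P]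
        (μ : Ω → EuclideanSpace ℝ (Fin L)) (θ : Ω → Fin K → ℝ) (Y : Ω → Fin T → ℝ)
        (J : Ω → Fin K), IsHierBandit p A P μ θ Y → IsDecision P θ Y J →
          expectedPoE P θ J ≤ C / Real.sqrt n := by
  refine ⟨fun n T A hA Ω _ P _ μ θ Y h => ⟨fun i j => h.variance_sub_posteriorMean hS hσ hA i j,
    fun J hJ => h.expectedPoE_le hS hσ₀ hσ hA hJ⟩,
    fun i j hij => HierParams.eventually_le_c hS hσ₀ hσ hω_pos hij,
    fun i => HierParams.eventually_div_le_margVar hS hσ₀ hσ hω_pos i, ?_⟩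
  obtain ⟨C, hC⟩ := HierParams.exists_poeBound_le hS hσ₀ hσ hω_pos
  exact ⟨C, fun n T A hn hA Ω _ P _ μ θ Y J h hJ =>
    (h.expectedPoE_le hS hσ₀ hσ hA hJ).trans (hC n hn)⟩
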